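/- **Models.** All reward distributions are on $\mathbb R$. Consider one of the following two models $(\mathcal P,\mathcal Q)$. (a) *Known support.* $\mathcal P=\mathcal Q$ is the set of all probability distributions with finite mean that are concentrated on a given measurable set $\mathcal S\subset\mathbb R$. For $\alpha\in[0,1]$, $\alpha Q+(1-\alpha)Q'$ denotes the mixture. The estimate computed from a sample is its empirical distribution. (b) *Exponential family.* $\mathcal Q=\{P_\theta:\theta\in\Theta\}$ with $dP_\theta=\exp(\theta^\top T(x)-A(\theta))\,dF(x)$, $\Theta\subset\mathbb R^d$, where $T:\mathbb R\to\mathbb R^d$ is measurable and $P_\theta$-integrable for each $\theta\in\Theta$, and the mean map $A':\theta\mapsto \mathbb E_{P_\theta}[T(X)]$ is injective on $\Theta$ with convex image; $\mathcal P=\{P_\theta:\theta\in\Theta'\}$ for some $\Theta'\subset\Theta$ such that each $P_\theta$, $\theta\in\Theta'$, has a finite mean. Here $\alpha Q+(1-\alpha)Q'$ denotes the member of $\mathcal Q$ under which the expectation of $T(X)$ is $\alpha\mathbb E_Q[T(X)]+(1-\alpha)\mathbb E_{Q'}[T(X)]$. The estimate computed from a sample is the member of $\mathcal Q$ under which the expectation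 of $T(X)$ is the sample average of $T$ (if there is one). **Notation.** Let $K\ge1$ be the number of arms, $\Delta_K$ the probability simplex in $\mathbb R^K$, $H:\mathcal P^K\to(0,\infty]$ arbitrary, $\mathcal I^*(P)$ the set of arms with the largest mean under $P\in\mathcal P^K$, and $D$ the Kullback–Leibler divergence, with values in $[0,\infty]$. Throughout, $0\cdot\infty=0$, $\infty/\infty=0$ and $\inf\emptyset=\infty$. For each $T$, let $\pi_T$ be a (possibly randomized) algorithm that in each of $T$ rounds draws an arm depending on the past arms and rewards, and finally recommends an arm $J(T)\in[K]$. Put $$R(\{\pi_T\})=\inf_{P\in\mathcal P^K}H(P)\liminf_{T\to\infty}\tfrac1T\log\frac1{\mathbb P_P[J(T)\notin\mathcal I^*(P)]},$$ $$R^{\mathrm{go}}=\sup_{r,J}\ \inf_{Q\in\mathcal Q^K}\ \inf_{P\in\mathcal P^K:\,J(Q)\notin\mathcal I^*(P)}H(P)\sum_{i}r_i(Q)D(Q_i\Vert P_i)$$ over all functions $r:\mathcal Q^K\to\Delta_K$, $J:\mathcal Q^K\to[K]$, and, for $B\ge1$, $R^{\mathrm{go}}_B=\sup_{r^B,J}V_B(r^B,J)$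 with $$V_B(r^B,J)=\inf_{Q^B\in\mathcal Q^{KB}}\ \inf_{P\in\mathcal P^K:\,J(Q^B)\notin\mathcal I^*(P)}\frac{H(P)}B\sum_{i\in[K],\,b\in[B]}r_{b,i}(Q_1,\dots,Q_b)\,D(Q_{b,i}\Vert P_i)$$ over all functions $r_b:\mathcal Q^{Kb}\to\Delta_K$ $(b\in[B])$ and $J:\mathcal Q^{KB}\to[K]$. **Delayed optimal tracking (DOT).** Let $(r^{B,*},J^*)$ be $\epsilon$-optimal, i.e. $V_B(r^{B,*},J^*)\ge R^{\mathrm{go}}_B-\epsilon$, $\epsilon>0$. There are $B+K-1$ batches of $T_B$ rounds. In batch $b\le K$ only arm $b$ is drawn, and $r_{b,i}=\mathbf 1[i=b]$. Let $Q_{b,i}\in\mathcal Q$ be the estimate computed from the rewards of arm $i$ in batch $b$ (an arbitrary element of $\mathcal Q$ if the arm is not drawn in that batch or the estimate does not exist in $\mathcal Q$). The stored estimates start with $Q'_{1,i}=Q_{i,i}$. In batch $b=K+1,\dots,B+K-1$, put $r_b=r^{B,*}_{b-K}(Q'_1,\dots,Q'_{b-K})$, draw each arm $i$ $n_{b,i}\ge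 r_{b,i}(T_B-K)$ times with $\sum_in_{b,i}=T_B$, and put $Q'_{b-K+1,i}=r_{b,i}Q_{b,i}+(1-r_{b,i})Q'_{b-K,i}$. Finally recommend $J=J^*(Q'_1,\dots,Q'_B)$. **Proposition.** In each of the models (a), (b): 0. For all $\alpha\in[0,1]$ and $Q,Q'\in\mathcal Q$ there is exactly one element of $\mathcal Q$ that is the convex combination $\alpha Q+(1-\alpha)Q'$, and $D(\alpha Q+(1-\alpha)Q'\Vert P)\le\alpha D(Q\Vert P)+(1-\alpha)D(Q'\Vert P)$ for all $P\in\mathcal Q$. 1. $R(\{\pi_T\})\le R^{\mathrm{go}}$ for every sequence of algorithms $\{\pi_T\}$. 2. $R(\{\pi_T\})\le R^{\mathrm{go}}_B$ for every sequence of algorithms $\{\pi_T\}$ and every $B\ge1$. 3. $R^{\mathrm{go}}_B\le R^{\mathrm{go}}$ for every $B\ge1$. 4. For every $B\ge1$, every $\epsilon>0$, every $\epsilon$-optimal $(r^{B,*},J^*)$, every run of DOT and every $P\in\mathcal P^K$ with $J\notin\mathcal I^*(P)$, $$\frac1{B+K-1}\sum_{i\in[K],\,b\in[B+K-1]}r_{b,i}D(Q_{b,i}\Vert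 P_i)\ \ge\ \frac B{B+K-1}\cdot\frac{R^{\mathrm{go}}_B-\epsilon}{H(P)}.$$ -/

import Mathlib

open MeasureTheory ProbabilityTheory InformationTheory Filter
open scoped ENNReal NNReal

noncomputable section

/-! ### Reward models -/

/-- The measure `exp (θᵀ T(x) - A(θ)) dF(x)`. -/
def expDist {d : ℕ} (F : Measure ℝ) (T : ℝ → EuclideanSpace ℝ (Fin d))
    (A : EuclideanSpace ℝ (Fin d) → ℝ) (θ : EuclideanSpace ℝ (Fin d)) : Measure ℝ :=
  F.withDensity fun x => ENNReal.ofReal (Real.exp (inner ℝ θ (T x) - A θ))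

/-- An exponential family on the real line with `d`-dimensional natural parameter. The field
`prob` forces `A θ` to be the log-partition function at every `θ ∈ Θ`. The last two fields say
that the mean map `A' : θ ↦ E_θ[T(X)]` has an inverse, defined on a convex set (so that averages
of means of the sufficient statistic are again such means). -/
structure ExpFamily (d : ℕ) where
  /-- base measure `F` -/
  base : Measure ℝ
  /-- sufficient statistic `T` -/
  stat : ℝ → EuclideanSpace ℝ (Fin d)
  /-- log-partition function `A` -/
  logPart : EuclideanSpace ℝ (Fin d) → ℝ
  /-- natural parameter set `Θ` -/
  param : Set (EuclideanSpace ℝ (Fin d))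
  stat_measurable : Measurable stat
  prob : ∀ θ ∈ param, IsProbabilityMeasure (expDist base stat logPart θ)
  stat_integrable : ∀ θ ∈ param, Integrable stat (expDist base stat logPart θ)
  meanMap_injOn : Set.InjOn (fun θ => ∫ x, stat x ∂(expDist base stat logPart θ)) param
  meanMap_convex :
    Convex ℝ ((fun θ => ∫ x, stat x ∂(expDist base stat logPart θ)) '' param)

/-- The distribution of the family with natural parameter `θ`. -/
def ExpFamily.dist {d : ℕ} (E : ExpFamily d) (θ : EuclideanSpace ℝ (Fin d)) : Measure ℝ :=
  expDist E.base E.stat E.logPart θ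

/-- The two kinds of models: all reward distributions (with a mean) on a known support `S`, or an
exponential family in which the true parameters are restricted to a subset `Θ'` of the natural
parameter set. -/
inductive RewardModel : Type
  | support (S : Set ℝ) (hS : MeasurableSet S) : RewardModel
  | expFamily {d : ℕ} (E : ExpFamily d) (Θ' : Set (EuclideanSpace ℝ (Fin d)))
      (hΘ' : Θ' ⊆ E.param) (hmean : ∀ θ ∈ Θ', Integrable (fun x : ℝ => x) (E.dist θ)) :
      RewardModel

namespace RewardModel

/-- The class `𝒫` of possible true reward distributions. -/
def classP : RewardModel → Set (ProbabilityMeasure ℝ)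
  | support S _ => {R | (R : Measure ℝ) Sᶜ = 0 ∧ Integrable (fun x : ℝ => x) (R : Measure ℝ)}
  | expFamily E Θ' _ _ => {R | ∃ θ ∈ Θ', (R : Measure ℝ) = E.dist θ}

/-- The class `𝒬 ⊇ 𝒫` of estimated reward distributions. -/
def classQ : RewardModel → Set (ProbabilityMeasure ℝ)
  | support S _ => {R | (R : Measure ℝ) Sᶜ = 0 ∧ Integrable (fun x : ℝ => x) (R : Measure ℝ)}
  | expFamily E _ _ _ => {R | ∃ θ ∈ E.param, (R : Measure ℝ) = E.dist θ}

/-- `M.IsConvexComb α Q Q' R`: the distribution `R` is the convex combination `α Q + (1 - α) Q'`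
in the sense of the model, that is, the mixture for distributions on a known support, and the
member of the family with the averaged mean of the sufficient statistic for exponential
families. -/
def IsConvexComb : RewardModel → ℝ →
    ProbabilityMeasure ℝ → ProbabilityMeasure ℝ → ProbabilityMeasure ℝ → Prop
  | support _ _, α, Q, Q', R =>
      (R : Measure ℝ) =
        ENNReal.ofReal α • (Q : Measure ℝ) + ENNReal.ofReal (1 - α) • (Q' : Measure ℝ)
  | expFamily E _ _ _, α, Q, Q', R =>
      ∫ x, E.stat x ∂(R : Measure ℝ) =
        α • ∫ x, E.stat x ∂(Q : Measure ℝ) + (1 - α) • ∫ x, E.stat x ∂(Q' : Measure ℝ)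

/-- `M.IsEstimate n x R`: the distribution `R` is the estimate computed from the `n ≥ 1` samples
`x 0, …, x (n - 1)`, that is, the empirical distribution for distributions on a known support, and
the member of the family that matches the empirical mean of the sufficient statistic for
exponential families. -/
def IsEstimate : RewardModel → (n : ℕ) → (ℕ → ℝ) → ProbabilityMeasure ℝ → Prop
  | support _ _, n, x, R =>
      (R : Measure ℝ) = (n : ℝ≥0∞)⁻¹ • ∑ m ∈ Finset.range n, Measure.dirac (x m)
  | expFamily E _ _ _, n, x, R =>
      ∫ y, E.stat y ∂(R : Measure ℝ) = (n : ℝ)⁻¹ • ∑ m ∈ Finset.range n, E.stat (x m)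

end RewardModel

/-- Kullback–Leibler divergence `D(Q ‖ P)`. -/
def KL (Q P : ProbabilityMeasure ℝ) : ℝ≥0∞ := klDiv (Q : Measure ℝ) (P : Measure ℝ)

/-- The set `ℐ*(P)` of best arms. -/
def bestArms {K : ℕ} (P : Fin K → ProbabilityMeasure ℝ) : Set (Fin K) :=
  {i | ∀ j, ∫ x, x ∂(P j : Measure ℝ) ≤ ∫ x, x ∂(P i : Measure ℝ)}

/-! ### Fixed-budget algorithms and their rate -/

/-- A (possibly randomized) fixed-budget algorithm with `K` arms and `T` rounds: the arm to draw
after `t` observed (arm, reward) pairs (only `t < T` matters), and the final recommendation. -/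
structure BanditAlg (K T : ℕ) where
  sample : (t : ℕ) → Kernel (Fin t → Fin K × ℝ) (Fin K)
  sample_markov : ∀ t, IsMarkovKernel (sample t)
  recommend : Kernel (Fin T → Fin K × ℝ) (Fin K)
  recommend_markov : IsMarkovKernel recommend

/-- The kernel that sends an arm to its reward distribution. -/
def armKernel {K : ℕ} (P : Fin K → ProbabilityMeasure ℝ) : Kernel (Fin K) ℝ :=
  Kernel.ofFunOfCountable fun i => (P i : Measure ℝ)

namespace BanditAlg

variable {K T : ℕ}

/-- The law of the first `t` (arm, reward) pairs when the arms have reward distributions `P`. -/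
def historyLaw (π : BanditAlg K T) (P : Fin K → ProbabilityMeasure ℝ) :
    (t : ℕ) → Measure (Fin t → Fin K × ℝ)
  | 0 => Measure.dirac (fun j => j.elim0)
  | t + 1 =>
      (π.historyLaw P t ⊗ₘ (π.sample t ⊗ₖ Kernel.prodMkLeft (Fin t → Fin K × ℝ) (armKernel P))).map
        (fun p => Fin.snoc (α := fun _ => Fin K × ℝ) p.1 p.2)

/-- The probability of error `ℙ[J(T) ∉ ℐ*(P)]`. -/
def errorProb (π : BanditAlg K T) (P : Fin K → ProbabilityMeasure ℝ) : ℝ≥0∞ :=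
  (π.historyLaw P T).bind π.recommend {i | i ∉ bestArms P}

end BanditAlg

/-- The worst-case rate
`R({π_T}) = inf_{P ∈ 𝒫^K} H(P) liminf_{T → ∞} (1/T) log (1 / ℙ[J(T) ∉ ℐ*(P)])`. -/
def worstCaseRate (M : RewardModel) {K : ℕ} (H : (Fin K → M.classP) → ℝ≥0∞)
    (π : (T : ℕ) → BanditAlg K T) : ℝ≥0∞ :=
  ⨅ P : Fin K → M.classP,
    H P * liminf (fun T : ℕ =>
      (ENNReal.log ((π T).errorProb fun i => (P i).1)⁻¹).toENNReal / (T : ℝ≥0∞)) atTop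

/-! ### Oracle rates -/

/-- The rate `R^go`. -/
def Rgo (M : RewardModel) {K : ℕ} (H : (Fin K → M.classP) → ℝ≥0∞) : ℝ≥0∞ :=
  ⨆ (r : (Fin K → M.classQ) → stdSimplex ℝ (Fin K)) (J : (Fin K → M.classQ) → Fin K),
    ⨅ (Q : Fin K → M.classQ) (P : Fin K → M.classP) (_ : J Q ∉ bestArms fun i => (P i).1),
      H P * ∑ i, ENNReal.ofReal ((r Q).1 i) * KL (Q i).1 (P i).1

/-- Batch allocation rules `r^B = (r_1, …, r_B)`: the allocation `r_b` is a function of the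
estimates of the batches up to and including the `b`-th one. Batches are numbered from `0`. -/
abbrev BatchAlloc (M : RewardModel) (K B : ℕ) : Type :=
  (b : Fin B) → (Fin (b.1 + 1) → Fin K → M.classQ) → stdSimplex ℝ (Fin K)

/-- Recommendation rules `J : 𝒬^{KB} → [K]`. -/
abbrev BatchRec (M : RewardModel) (K B : ℕ) : Type :=
  (Fin B → Fin K → M.classQ) → Fin K

/-- The value of a batch oracle `(r^B, J)`:
`inf_{Q^B} inf_{P : J(Q^B) ∉ ℐ*(P)} (H(P)/B) ∑_{i, b} r_{b,i}(Q^b) D(Q_{b,i} ‖ P_i)`. -/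
def batchValue (M : RewardModel) {K B : ℕ} (H : (Fin K → M.classP) → ℝ≥0∞)
    (r : BatchAlloc M K B) (J : BatchRec M K B) : ℝ≥0∞ :=
  ⨅ (Q : Fin B → Fin K → M.classQ) (P : Fin K → M.classP)
    (_ : J Q ∉ bestArms fun i => (P i).1),
      H P / (B : ℝ≥0∞) * ∑ i, ∑ b : Fin B,
        ENNReal.ofReal ((r b fun c => Q (Fin.castLE b.2 c)).1 i) * KL (Q b i).1 (P i).1

/-- The rate `R^go_B`. -/
def RgoB (M : RewardModel) {K : ℕ} (H : (Fin K → M.classP) → ℝ≥0∞) (B : ℕ) : ℝ≥0∞ :=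
  ⨆ (r : BatchAlloc M K B) (J : BatchRec M K B), batchValue M H r J

/-! ### Delayed optimal tracking -/

/-- A run of the delayed optimal tracking algorithm with `B + K - 1` batches of size `TB`, driven
by the batch oracle `(r^{B,*}, J^*)`. Batches are numbered from `0`; `rewards b i m` is the reward
of the `m`-th draw of arm `i` in batch `b`. Only `estimate b` with `b < B + K - 1` and `stored a`
with `a < B` matter. The estimate of arm `i` in batch `b` is the one computed from the rewards of
that arm in that batch; when the arm is not drawn, or when no member of `𝒬` matches its rewards,
it may be any member of `𝒬`. -/
structure DOTRun (M : RewardModel) {K B : ℕ} (rstar : BatchAlloc M K B) (Jstar : BatchRec M K B)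
    where
  /-- batch size `T_B` -/
  TB : ℕ
  /-- allocation `r_b` -/
  alloc : ℕ → stdSimplex ℝ (Fin K)
  /-- numbers of draws `n_{b,i}` -/
  draws : ℕ → Fin K → ℕ
  /-- observed rewards -/
  rewards : ℕ → Fin K → ℕ → ℝ
  /-- estimates `Q_{b,i}` -/
  estimate : ℕ → Fin K → M.classQ
  /-- stored estimates `Q'_{a,i}` -/
  stored : ℕ → Fin K → M.classQ
  /-- recommended arm -/
  recommended : Fin K
  alloc_init : ∀ b : Fin K, (alloc b).1 = Pi.single b 1
  draws_init : ∀ b i : Fin K, draws b i = if i = b then TB else 0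
  alloc_track : ∀ (a : ℕ) (ha : a + 1 < B),
    alloc (K + a) = rstar ⟨a, by omega⟩ fun c => stored c
  draws_track : ∀ a : ℕ, a + 1 < B →
    (∀ i, (alloc (K + a)).1 i * ((TB : ℝ) - K) ≤ (draws (K + a) i : ℝ)) ∧
      ∑ i, draws (K + a) i = TB
  estimate_spec : ∀ b < B + K - 1, ∀ i, 0 < draws b i →
    (∃ R ∈ M.classQ, M.IsEstimate (draws b i) (rewards b i) R) →
      M.IsEstimate (draws b i) (rewards b i) (estimate b i).1
  stored_init : ∀ i : Fin K, stored 0 i = estimate i i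
  stored_update : ∀ a : ℕ, a + 1 < B → ∀ i,
    M.IsConvexComb ((alloc (K + a)).1 i) (estimate (K + a) i).1 (stored a i).1
      (stored (a + 1) i).1
  recommended_eq : recommended = Jstar fun b => stored b

end

/-!
The divergence `D` is convex in its first argument: for mixtures because the integrand `klFun` is
convex (`klDiv_mixture_le`), and in an exponential family because the defect of convexity at the
averaged mean is `α D(Q ‖ R) + (1 - α) D(Q' ‖ R)`, a combination of divergences
(`ExpFamily.klDiv_dist_le`). The guarantee of delayed optimal tracking is a telescoping sum: by
convexity, merging a new estimate into the stored one costs at most the divergence that the new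
batch has collected (`DOTRun.sum_stored_le`). A batch oracle restricted to constant sequences of
estimates is an ordinary oracle (`RgoB_le_Rgo`), so the bound of the rate by the oracle rate is the
case of one batch of the bound by the batch oracle rate.

That bound, `worstCaseRate_le_RgoB`, is a change of measure. Fix `ε > 0` and let the reward
distributions be `Q b` throughout batch `b`. The empirical allocation of a batch lies within `ε` of
an element of a finite net of the simplex. By the pigeonhole principle one can choose, batch after
batch, elements `c b` of the net such that the event of following `c` up to `ε` has probability not
tending to zero as `T → ∞`; the choice for batch `b` sees only the distributions of the batches up
to `b`, because these determine the probability of the event. A last use of the pigeonhole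
principle gives an arm `j` recommended on that event (`exists_typical_rules`). On the event, the
log-likelihood ratio between `Q` and a stationary environment `P` is at most
`(T / B) ∑ (c_{b,i} + ε) D(Q_{b,i} ‖ P_i) + o(T)` with high probability. This is a law of large
numbers for adaptively sampled rewards, for which each one-round ratio is split into a bounded part,
treated by Chernoff's bound, and a part that is small in `L¹`, treated by Markov's inequality
(`exists_llr_bound`, `lintegral_chainLaw_change_of_measure`). Hence `j` is recommended under `P`
with at least the corresponding exponentially small probability (`liminf_rate_le`). The oracle that
allocates `(c + ε) / (1 + K ε)` thus attains the rate of the algorithm up to the factor `1 + K ε`.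
All its weights are positive, so that the convention `0 · ∞ = 0` never hides an infinite
divergence.
-/

/-! ### Convex combinations and convexity of the divergence -/

/-- The Kullback–Leibler divergence is convex in its first argument with respect to mixtures. -/
theorem klDiv_mixture_le {Ω : Type*} [MeasurableSpace Ω] (μ₁ μ₂ ν : Measure Ω)
    [IsProbabilityMeasure μ₁] [IsProbabilityMeasure μ₂] [IsProbabilityMeasure ν]
    {a b : ℝ} (ha : 0 ≤ a) (hb : 0 ≤ b) (hab : a + b = 1) :
    klDiv (ENNReal.ofReal a • μ₁ + ENNReal.ofReal b • μ₂) ν ≤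
      ENNReal.ofReal a * klDiv μ₁ ν + ENNReal.ofReal b * klDiv μ₂ ν := by
  rcases ha.eq_or_lt with rfl | ha0
  · obtain rfl : b = 1 := by linarith
    simp
  rcases hb.eq_or_lt with rfl | hb0
  · obtain rfl : a = 1 := by linarith
    simp
  have hae : ENNReal.ofReal a ≠ 0 := by simpa using ha0
  have hbe : ENNReal.ofReal b ≠ 0 := by simpa using hb0
  by_cases h1 : klDiv μ₁ ν = ⊤
  · simp [h1, ENNReal.mul_top hae]
  by_cases h2 : klDiv μ₂ ν = ⊤
  · simp [h2, ENNReal.mul_top hbe]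
  have ac1 := (klDiv_ne_top_iff.1 h1).1
  have ac2 := (klDiv_ne_top_iff.1 h2).1
  have acs1 : ENNReal.ofReal a • μ₁ ≪ ν := ac1.smul_left _
  have acs2 : ENNReal.ofReal b • μ₂ ≪ ν := ac2.smul_left _
  have : IsFiniteMeasure (ENNReal.ofReal a • μ₁) := Measure.smul_finite _ ENNReal.ofReal_ne_top
  have : IsFiniteMeasure (ENNReal.ofReal b • μ₂) := Measure.smul_finite _ ENNReal.ofReal_ne_top
  have acm : ENNReal.ofReal a • μ₁ + ENNReal.ofReal b • μ₂ ≪ ν :=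
    Measure.AbsolutelyContinuous.add_left acs1 acs2
  rw [klDiv_eq_lintegral_klFun_of_ac acm, klDiv_eq_lintegral_klFun_of_ac ac1,
    klDiv_eq_lintegral_klFun_of_ac ac2, ← lintegral_const_mul, ← lintegral_const_mul,
    ← lintegral_add_left]
  rotate_left
  · fun_prop
  · fun_prop
  · fun_prop
  refine lintegral_mono_ae ?_
  filter_upwards [Measure.rnDeriv_add' (ENNReal.ofReal a • μ₁) (ENNReal.ofReal b • μ₂) ν,
    Measure.rnDeriv_smul_left_of_ne_top' μ₁ ν (r := ENNReal.ofReal a) ENNReal.ofReal_ne_top,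
    Measure.rnDeriv_smul_left_of_ne_top' μ₂ ν (r := ENNReal.ofReal b) ENNReal.ofReal_ne_top,
    Measure.rnDeriv_ne_top μ₁ ν, Measure.rnDeriv_ne_top μ₂ ν] with x e1 e2 e3 f1 f2
  rw [e1, Pi.add_apply, e2, e3, Pi.smul_apply, Pi.smul_apply, smul_eq_mul, smul_eq_mul,
    ENNReal.toReal_add (ENNReal.mul_ne_top ENNReal.ofReal_ne_top f1)
      (ENNReal.mul_ne_top ENNReal.ofReal_ne_top f2), ENNReal.toReal_mul, ENNReal.toReal_mul,
    ENNReal.toReal_ofReal ha, ENNReal.toReal_ofReal hb, ← ENNReal.ofReal_mul ha,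
    ← ENNReal.ofReal_mul hb, ← ENNReal.ofReal_add
      (mul_nonneg ha (klFun_nonneg ENNReal.toReal_nonneg))
      (mul_nonneg hb (klFun_nonneg ENNReal.toReal_nonneg))]
  refine ENNReal.ofReal_le_ofReal ?_
  have := convexOn_klFun.2 (x := (μ₁.rnDeriv ν x).toReal) (y := (μ₂.rnDeriv ν x).toReal)
    ENNReal.toReal_nonneg ENNReal.toReal_nonneg ha hb hab
  simpa using this

namespace ExpFamily

variable {d : ℕ} (E : ExpFamily d)

/-- The mean map `θ ↦ E_θ[T(X)]`. -/
noncomputable def mean (θ : EuclideanSpace ℝ (Fin d)) : EuclideanSpace ℝ (Fin d) :=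
  ∫ x, E.stat x ∂(E.dist θ)

theorem dist_eq_withDensity (θ η : EuclideanSpace ℝ (Fin d)) :
    E.dist θ = (E.dist η).withDensity fun x =>
      ENNReal.ofReal (Real.exp (inner ℝ (θ - η) (E.stat x) - (E.logPart θ - E.logPart η))) := by
  have hT := E.stat_measurable
  rw [ExpFamily.dist, ExpFamily.dist, expDist, expDist, ← withDensity_mul _ (by fun_prop)
    (by fun_prop)]
  congr 1
  ext x
  rw [Pi.mul_apply, ← ENNReal.ofReal_mul (Real.exp_nonneg _), ← Real.exp_add, inner_sub_left]
  congr 2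
  ring

/-- Within an exponential family `D(P_θ ‖ P_η) = ⟨θ - η, E_θ[T]⟩ - (A(θ) - A(η))`. -/
theorem klDiv_dist {θ η : EuclideanSpace ℝ (Fin d)} (hθ : θ ∈ E.param) (hη : η ∈ E.param) :
    klDiv (E.dist θ) (E.dist η) =
        ENNReal.ofReal (inner ℝ (θ - η) (E.mean θ) - (E.logPart θ - E.logPart η)) ∧
      0 ≤ inner ℝ (θ - η) (E.mean θ) - (E.logPart θ - E.logPart η) := by
  have hT := E.stat_measurable
  have : IsProbabilityMeasure (E.dist θ) := E.prob θ hθ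
  have : IsProbabilityMeasure (E.dist η) := E.prob η hη
  have hint : Integrable E.stat (E.dist θ) := E.stat_integrable θ hθ
  have hac : E.dist θ ≪ E.dist η := by
    rw [E.dist_eq_withDensity θ η]
    exact withDensity_absolutelyContinuous _ _
  have hllr : llr (E.dist θ) (E.dist η) =ᵐ[E.dist θ]
      fun x => inner ℝ (θ - η) (E.stat x) - (E.logPart θ - E.logPart η) := by
    have h : (E.dist θ).rnDeriv (E.dist η) =ᵐ[E.dist η] fun x =>
        ENNReal.ofReal
          (Real.exp (inner ℝ (θ - η) (E.stat x) - (E.logPart θ - E.logPart η))) := by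
      conv_lhs => rw [E.dist_eq_withDensity θ η]
      exact Measure.rnDeriv_withDensity _ (by fun_prop)
    filter_upwards [hac.ae_le h] with x hx
    rw [llr, hx, ENNReal.toReal_ofReal (Real.exp_nonneg _), Real.log_exp]
  have hinner : Integrable (fun x => inner ℝ (θ - η) (E.stat x)) (E.dist θ) :=
    hint.const_inner _
  have hI : Integrable (llr (E.dist θ) (E.dist η)) (E.dist θ) :=
    (hinner.sub (integrable_const _)).congr hllr.symm
  have hval : ∫ x, llr (E.dist θ) (E.dist η) x ∂(E.dist θ) =
      inner ℝ (θ - η) (E.mean θ) - (E.logPart θ - E.logPart η) := by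
    rw [integral_congr_ae hllr, integral_sub hinner (integrable_const _), integral_inner hint]
    simp [mean]
  constructor
  · rw [klDiv_of_ac_of_integrable hac hI, hval]
    simp
  · have := integral_llr_add_sub_measure_univ_nonneg hac hI
    rw [hval] at this
    simpa using this

/-- The divergence is convex in its first argument with respect to averaging the means of the
sufficient statistic: for `R` with mean `α E_Q[T] + (1 - α) E_{Q'}[T]`, the defect
`α D(Q ‖ P) + (1 - α) D(Q' ‖ P) - D(R ‖ P)` equals `α D(Q ‖ R) + (1 - α) D(Q' ‖ R)`. -/
theorem klDiv_dist_le {α : ℝ} (h0 : 0 ≤ α) (h1 : α ≤ 1) {q q' r p : EuclideanSpace ℝ (Fin d)}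
    (hq : q ∈ E.param) (hq' : q' ∈ E.param) (hr : r ∈ E.param) (hp : p ∈ E.param)
    (hm : E.mean r = α • E.mean q + (1 - α) • E.mean q') :
    klDiv (E.dist r) (E.dist p) ≤
      ENNReal.ofReal α * klDiv (E.dist q) (E.dist p) +
        ENNReal.ofReal (1 - α) * klDiv (E.dist q') (E.dist p) := by
  have h1' : 0 ≤ 1 - α := by linarith
  obtain ⟨e, hn⟩ := E.klDiv_dist hq hp
  obtain ⟨e', hn'⟩ := E.klDiv_dist hq' hp
  have hqr := mul_nonneg h0 (E.klDiv_dist hq hr).2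
  have hqr' := mul_nonneg h1' (E.klDiv_dist hq' hr).2
  rw [(E.klDiv_dist hr hp).1, e, e', ← ENNReal.ofReal_mul h0, ← ENNReal.ofReal_mul h1',
    ← ENNReal.ofReal_add (mul_nonneg h0 hn) (mul_nonneg h1' hn')]
  refine ENNReal.ofReal_le_ofReal ?_
  rw [hm]
  simp only [inner_sub_left, inner_add_right, inner_smul_right] at hqr hqr' ⊢
  linarith

end ExpFamily

namespace RewardModel

theorem classP_subset_classQ (M : RewardModel) : M.classP ⊆ M.classQ := by
  cases M with
  | support S hS => exact subset_rfl
  | expFamily E Θ' hΘ' hmean => exact fun R ⟨θ, hθ, h⟩ => ⟨θ, hΘ' hθ, h⟩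

theorem existsUnique_isConvexComb (M : RewardModel) {α : ℝ} (h0 : 0 ≤ α) (h1 : α ≤ 1)
    {Q Q' : ProbabilityMeasure ℝ} (hQ : Q ∈ M.classQ) (hQ' : Q' ∈ M.classQ) :
    ∃! R, R ∈ M.classQ ∧ M.IsConvexComb α Q Q' R := by
  have h1' : 0 ≤ 1 - α := by linarith
  cases M with
  | support S hS =>
    have hp : IsProbabilityMeasure
        (ENNReal.ofReal α • (Q : Measure ℝ) + ENNReal.ofReal (1 - α) • (Q' : Measure ℝ)) :=
      ⟨by simp [← ENNReal.ofReal_add h0 h1']⟩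
    refine ⟨⟨_, hp⟩, ⟨⟨?_, ?_⟩, rfl⟩, fun R hR => Subtype.ext hR.2⟩
    · change (ENNReal.ofReal α • (Q : Measure ℝ) + ENNReal.ofReal (1 - α) • (Q' : Measure ℝ)) Sᶜ = 0
      simp [hQ.1, hQ'.1]
    · exact (hQ.2.smul_measure ENNReal.ofReal_ne_top).add_measure
        (hQ'.2.smul_measure ENNReal.ofReal_ne_top)
  | expFamily E Θ' hΘ' hmean =>
    obtain ⟨q, hq, eq⟩ := hQ
    obtain ⟨q', hq', eq'⟩ := hQ'
    obtain ⟨r, hr, er⟩ := E.meanMap_convex ⟨q, hq, rfl⟩ ⟨q', hq', rfl⟩ h0 h1' (by ring)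
    refine ⟨⟨E.dist r, E.prob r hr⟩, ⟨⟨r, hr, rfl⟩, ?_⟩, ?_⟩
    · change ∫ x, E.stat x ∂(E.dist r) = _
      rw [eq, eq']
      exact er
    · rintro R ⟨⟨s, hs, es⟩, hc⟩
      refine Subtype.ext (es.trans (congrArg E.dist ?_))
      refine E.meanMap_injOn hs hr ?_
      change ∫ x, E.stat x ∂(R : Measure ℝ) = _ at hc
      rw [es, eq, eq'] at hc
      exact hc.trans er.symm

theorem kl_le_of_isConvexComb (M : RewardModel) {α : ℝ} (h0 : 0 ≤ α) (h1 : α ≤ 1)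
    {Q Q' R P : ProbabilityMeasure ℝ} (hQ : Q ∈ M.classQ) (hQ' : Q' ∈ M.classQ)
    (hR : R ∈ M.classQ) (hc : M.IsConvexComb α Q Q' R) (hP : P ∈ M.classQ) :
    KL R P ≤ ENNReal.ofReal α * KL Q P + ENNReal.ofReal (1 - α) * KL Q' P := by
  cases M with
  | support S hS =>
    change (R : Measure ℝ) = _ at hc
    rw [KL, hc]
    exact klDiv_mixture_le _ _ _ h0 (by linarith) (by ring)
  | expFamily E Θ' hΘ' hmean =>
    obtain ⟨q, hq, eq⟩ := hQ
    obtain ⟨q', hq', eq'⟩ := hQ'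
    obtain ⟨r, hr, er⟩ := hR
    obtain ⟨p, hp, ep⟩ := hP
    change ∫ x, E.stat x ∂(R : Measure ℝ) = _ at hc
    rw [er, eq, eq'] at hc
    rw [KL, KL, KL, er, eq, eq', ep]
    exact E.klDiv_dist_le h0 h1 hq hq' hr hp hc

end RewardModel

/-! ### Batch oracles and delayed optimal tracking -/

theorem stdSimplex_coord_le_one {K : ℕ} (r : stdSimplex ℝ (Fin K)) (i : Fin K) : r.1 i ≤ 1 :=
  r.2.2 ▸ Finset.single_le_sum (fun j _ => r.2.1 j) (Finset.mem_univ i)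

/-- A batch oracle restricted to constant sequences of estimates is an oracle, whose allocation is
the average of the batch allocations. -/
theorem RgoB_le_Rgo (M : RewardModel) {K : ℕ} (H : (Fin K → M.classP) → ℝ≥0∞) {B : ℕ}
    (hB : 1 ≤ B) : RgoB M H B ≤ Rgo M H := by
  refine iSup₂_le fun r J => ?_
  have hB0 : (0 : ℝ) < B := by exact_mod_cast hB
  let avg (Q : Fin K → M.classQ) : stdSimplex ℝ (Fin K) :=
    ⟨fun i => (∑ b : Fin B, (r b fun _ => Q).1 i) / B, fun i =>
      div_nonneg (Finset.sum_nonneg fun b _ => (r b fun _ => Q).2.1 i) hB0.le, by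
        rw [← Finset.sum_div, Finset.sum_comm, Finset.sum_congr rfl fun b _ => (r b fun _ => Q).2.2]
        simp [hB0.ne']⟩
  refine le_trans ?_ (le_iSup₂ (f := fun (r : (Fin K → M.classQ) → stdSimplex ℝ (Fin K))
    (J : (Fin K → M.classQ) → Fin K) => ⨅ (Q : Fin K → M.classQ) (P : Fin K → M.classP)
      (_ : J Q ∉ bestArms fun i => (P i).1),
      H P * ∑ i, ENNReal.ofReal ((r Q).1 i) * KL (Q i).1 (P i).1) avg (fun Q => J fun _ => Q))
  refine le_iInf fun Q => le_iInf₂ fun P hP => ?_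
  refine (iInf_le_of_le (fun _ => Q) (iInf₂_le P hP)).trans (le_of_eq ?_)
  rw [ENNReal.div_eq_inv_mul, mul_assoc, mul_left_comm]
  congr 1
  rw [Finset.mul_sum]
  refine Finset.sum_congr rfl fun i _ => ?_
  rw [← Finset.sum_mul, ← mul_assoc]
  congr 1
  rw [← ENNReal.ofReal_sum_of_nonneg fun b _ => (r b fun _ => Q).2.1 i,
    ENNReal.ofReal_div_of_pos hB0, ENNReal.ofReal_natCast, ENNReal.div_eq_inv_mul]

/-- Updating the stored estimates loses no divergence: by convexity, replacing `Q'_{a,i}` by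
`r Q_{K+a,i} + (1 - r) Q'_{a,i}` costs at most the divergence gained from the new batch, so the sums
telescope. -/
theorem DOTRun.sum_stored_le {M : RewardModel} {K B : ℕ} {rstar : BatchAlloc M K B}
    {Jstar : BatchRec M K B} (run : DOTRun M rstar Jstar) (P : ProbabilityMeasure ℝ)
    (hP : P ∈ M.classQ) (i : Fin K) (n : ℕ) (hn : n < B) :
    KL (run.stored n i).1 P +
        ∑ a ∈ Finset.range n, ENNReal.ofReal ((run.alloc (K + a)).1 i) * KL (run.stored a i).1 P ≤
      KL (run.estimate i i).1 P +
        ∑ a ∈ Finset.range n,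
          ENNReal.ofReal ((run.alloc (K + a)).1 i) * KL (run.estimate (K + a) i).1 P := by
  induction n with
  | zero => simp [run.stored_init]
  | succ n ih =>
    have h0 := (run.alloc (K + n)).2.1 i
    have h1 := stdSimplex_coord_le_one (run.alloc (K + n)) i
    have hk := M.kl_le_of_isConvexComb h0 h1 (run.estimate (K + n) i).2 (run.stored n i).2
      (run.stored (n + 1) i).2 (run.stored_update n hn i) hP
    have hs : ENNReal.ofReal (1 - (run.alloc (K + n)).1 i) * KL (run.stored n i).1 P +
        ENNReal.ofReal ((run.alloc (K + n)).1 i) * KL (run.stored n i).1 P =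
          KL (run.stored n i).1 P := by
      rw [← add_mul, ← ENNReal.ofReal_add (by linarith) h0]
      simp
    rw [Finset.sum_range_succ, Finset.sum_range_succ]
    set S := ∑ a ∈ Finset.range n,
      ENNReal.ofReal ((run.alloc (K + a)).1 i) * KL (run.stored a i).1 P
    set S' := ∑ a ∈ Finset.range n,
      ENNReal.ofReal ((run.alloc (K + a)).1 i) * KL (run.estimate (K + a) i).1 P
    set e := ENNReal.ofReal ((run.alloc (K + n)).1 i) * KL (run.estimate (K + n) i).1 P
    set s := ENNReal.ofReal ((run.alloc (K + n)).1 i) * KL (run.stored n i).1 P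
    set s' := ENNReal.ofReal (1 - (run.alloc (K + n)).1 i) * KL (run.stored n i).1 P
    calc KL (run.stored (n + 1) i).1 P + (S + s) ≤ (e + s') + (S + s) := by gcongr
      _ = e + ((s' + s) + S) := by ring
      _ ≤ e + (KL (run.estimate i i).1 P + S') := by
          rw [hs]
          exact add_le_add le_rfl (ih (by omega))
      _ = _ := by ring

theorem DOTRun.divergence_guarantee {M : RewardModel} {K B : ℕ} (hB : 1 ≤ B)
    {H : (Fin K → M.classP) → ℝ≥0∞}
    {rstar : BatchAlloc M K B} {Jstar : BatchRec M K B} {v : ℝ≥0∞}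
    (hv : v ≤ batchValue M H rstar Jstar) (run : DOTRun M rstar Jstar) (P : Fin K → M.classP)
    (hP : run.recommended ∉ bestArms (fun i => (P i).1)) :
    (B : ℝ≥0∞) / ((B + K - 1 : ℕ) : ℝ≥0∞) * (v / H P) ≤
      ((B + K - 1 : ℕ) : ℝ≥0∞)⁻¹ *
        ∑ i, ∑ b ∈ Finset.range (B + K - 1),
          ENNReal.ofReal ((run.alloc b).1 i) * KL (run.estimate b i).1 (P i).1 := by
  obtain ⟨n, rfl⟩ : ∃ n, B = n + 1 := ⟨B - 1, by omega⟩
  set S := ∑ i, ∑ b ∈ Finset.range (n + 1 + K - 1),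
    ENNReal.ofReal ((run.alloc b).1 i) * KL (run.estimate b i).1 (P i).1 with hS
  have hPQ : ∀ i, (P i).1 ∈ M.classQ := fun i => M.classP_subset_classQ (P i).2
  rw [run.recommended_eq] at hP
  have h1 : v ≤ H P / ((n + 1 : ℕ) : ℝ≥0∞) * ∑ i, ∑ b : Fin (n + 1), ENNReal.ofReal
      ((rstar b fun c => run.stored c).1 i) * KL (run.stored b i).1 (P i).1 :=
    hv.trans (iInf_le_of_le (fun b : Fin (n + 1) => run.stored b) (iInf₂_le P hP))
  have h2 : ∑ i, ∑ b : Fin (n + 1), ENNReal.ofReal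
      ((rstar b fun c => run.stored c).1 i) * KL (run.stored b i).1 (P i).1 ≤ S := by
    refine Finset.sum_le_sum fun i _ => ?_
    rw [Fin.sum_univ_castSucc]
    have e1 : ∑ b : Fin n, ENNReal.ofReal ((rstar b.castSucc fun c => run.stored c).1 i) *
        KL (run.stored b.castSucc i).1 (P i).1 = ∑ a ∈ Finset.range n,
        ENNReal.ofReal ((run.alloc (K + a)).1 i) * KL (run.stored a i).1 (P i).1 := by
      rw [Finset.sum_range]
      refine Finset.sum_congr rfl fun b _ => ?_
      rw [run.alloc_track b (by omega)]
      rfl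
    rw [e1, add_comm]
    -- the allocation of the last batch is at most one, so the last stored estimate bounds its term
    have e2 : ENNReal.ofReal ((rstar (Fin.last n) fun c => run.stored c).1 i) *
        KL (run.stored (Fin.last n) i).1 (P i).1 ≤ KL (run.stored n i).1 (P i).1 := by
      refine mul_le_of_le_one_left' ?_
      rw [ENNReal.ofReal_le_one]
      exact stdSimplex_coord_le_one _ i
    refine (add_le_add_left e2 _).trans ((run.sum_stored_le _ (hPQ i) i n (by omega)).trans ?_)
    rw [show n + 1 + K - 1 = K + n by omega, Finset.sum_range_add]
    refine add_le_add_left ?_ _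
    refine le_trans (le_of_eq ?_) (Finset.single_le_sum (f := fun b =>
      ENNReal.ofReal ((run.alloc b).1 i) * KL (run.estimate b i).1 (P i).1)
      (fun _ _ => zero_le) (Finset.mem_range.2 i.2))
    simp [run.alloc_init]
  have h3 : v / H P ≤ S / ((n + 1 : ℕ) : ℝ≥0∞) := by
    refine ENNReal.div_le_of_le_mul ((h1.trans (mul_le_mul_right h2 _)).trans (le_of_eq ?_))
    rw [ENNReal.div_eq_inv_mul, ENNReal.div_eq_inv_mul]
    ring
  refine (mul_le_mul_right h3 _).trans (le_of_eq ?_)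
  rw [ENNReal.div_eq_inv_mul, mul_assoc, ENNReal.mul_div_cancel (by simp) (by simp)]

/-! ### Laws of sequentially sampled histories -/

section Chain

variable {Y : Type*} [MeasurableSpace Y]

/-- The law of the first `t` observations when, given the history, the next observation is drawn
from the kernel `κ t`. -/
noncomputable def chainLaw (κ : (t : ℕ) → Kernel (Fin t → Y) Y) :
    (t : ℕ) → Measure (Fin t → Y)
  | 0 => Measure.dirac fun j => j.elim0
  | t + 1 => (chainLaw κ t ⊗ₘ κ t).map fun p => Fin.snoc (α := fun _ => Y) p.1 p.2

theorem measurable_snoc (t : ℕ) :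
    Measurable fun p : (Fin t → Y) × Y => Fin.snoc (α := fun _ => Y) p.1 p.2 := by
  refine measurable_pi_lambda _ fun s => ?_
  induction s using Fin.lastCases with
  | last => simpa using measurable_snd
  | cast s =>
    simp only [Fin.snoc_castSucc]
    exact (measurable_pi_apply s).comp measurable_fst

variable (κ κ' : (t : ℕ) → Kernel (Fin t → Y) Y) [∀ t, IsMarkovKernel (κ t)]
  [∀ t, IsMarkovKernel (κ' t)]

instance isProbabilityMeasure_chainLaw (t : ℕ) : IsProbabilityMeasure (chainLaw κ t) := by
  induction t with
  | zero => exact Measure.dirac.isProbabilityMeasure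
  | succ t ih => exact Measure.isProbabilityMeasure_map (measurable_snoc t).aemeasurable

theorem lintegral_chainLaw_succ (t : ℕ) {g : (Fin (t + 1) → Y) → ℝ≥0∞} (hg : Measurable g) :
    ∫⁻ h, g h ∂(chainLaw κ (t + 1)) =
      ∫⁻ h, ∫⁻ y, g (Fin.snoc (α := fun _ => Y) h y) ∂(κ t h) ∂(chainLaw κ t) := by
  have hm : Measurable fun p : (Fin t → Y) × Y => g (Fin.snoc (α := fun _ => Y) p.1 p.2) :=
    hg.comp (measurable_snoc t)
  rw [chainLaw, lintegral_map hg (measurable_snoc t), Measure.lintegral_compProd hm]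

/-- A product of factors whose conditional expectations are at most one has expectation at most
one. -/
theorem lintegral_chainLaw_prod_le_one {e : ℕ → Y → ℝ≥0∞} (he : ∀ t, Measurable (e t))
    (h1 : ∀ t h, ∫⁻ y, e t y ∂(κ t h) ≤ 1) (t : ℕ) :
    ∫⁻ h, ∏ s : Fin t, e s (h s) ∂(chainLaw κ t) ≤ 1 := by
  induction t with
  | zero => simp
  | succ t ih =>
    rw [lintegral_chainLaw_succ κ t (by fun_prop)]
    refine le_trans (lintegral_mono fun h => ?_) ih
    simp only [Fin.prod_univ_castSucc, Fin.snoc_castSucc, Fin.snoc_last, Fin.val_castSucc,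
      Fin.val_last]
    rw [lintegral_const_mul _ (he t)]
    exact mul_le_of_le_one_right' (h1 t h)

theorem lintegral_chainLaw_sum_le {e : ℕ → Y → ℝ≥0∞} (he : ∀ t, Measurable (e t)) {η : ℝ≥0∞}
    (h1 : ∀ t h, ∫⁻ y, e t y ∂(κ t h) ≤ η) (t : ℕ) :
    ∫⁻ h, ∑ s : Fin t, e s (h s) ∂(chainLaw κ t) ≤ t * η := by
  induction t with
  | zero => simp
  | succ t ih =>
    rw [lintegral_chainLaw_succ κ t (by fun_prop)]
    simp only [Fin.sum_univ_castSucc, Fin.snoc_castSucc, Fin.snoc_last, Fin.val_castSucc,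
      Fin.val_last]
    calc ∫⁻ h, ∫⁻ y, (∑ s : Fin t, e s (h s) + e t y) ∂(κ t h) ∂(chainLaw κ t)
        ≤ ∫⁻ h, (∑ s : Fin t, e s (h s) + η) ∂(chainLaw κ t) := by
          refine lintegral_mono fun h => ?_
          rw [lintegral_add_left measurable_const]
          simpa using add_le_add le_rfl (h1 t h)
      _ ≤ t * η + η := by
          rw [lintegral_add_right _ measurable_const]
          simpa using add_le_add ih le_rfl
      _ = (t + 1 : ℕ) * η := by push_cast; ring

/-- Change of measure along a history. -/
theorem lintegral_chainLaw_le_of_density {f : ℕ → Y → ℝ≥0∞} (hf : ∀ t, Measurable (f t))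
    (hκ : ∀ t h (g : Y → ℝ≥0∞), Measurable g →
      ∫⁻ y, g y ∂(κ t h) ≤ ∫⁻ y, f t y * g y ∂(κ' t h)) (t : ℕ)
    {g : (Fin t → Y) → ℝ≥0∞} (hg : Measurable g) :
    ∫⁻ h, g h ∂(chainLaw κ t) ≤ ∫⁻ h, (∏ s : Fin t, f s (h s)) * g h ∂(chainLaw κ' t) := by
  induction t with
  | zero => simp [chainLaw]
  | succ t ih =>
    have hm : Measurable fun p : (Fin t → Y) × Y => g (Fin.snoc (α := fun _ => Y) p.1 p.2) :=
      hg.comp (measurable_snoc t)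
    rw [lintegral_chainLaw_succ κ t hg, lintegral_chainLaw_succ κ' t (by fun_prop)]
    simp only [Fin.prod_univ_castSucc, Fin.snoc_castSucc, Fin.snoc_last, Fin.val_castSucc,
      Fin.val_last]
    calc ∫⁻ h, ∫⁻ y, g (Fin.snoc (α := fun _ => Y) h y) ∂(κ t h) ∂(chainLaw κ t)
        ≤ ∫⁻ h, ∫⁻ y, f t y * g (Fin.snoc (α := fun _ => Y) h y) ∂(κ' t h) ∂(chainLaw κ t) :=
          lintegral_mono fun h => hκ t h _ (hm.comp measurable_prodMk_left)
      _ ≤ ∫⁻ h, (∏ s : Fin t, f s (h s)) *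
            ∫⁻ y, f t y * g (Fin.snoc (α := fun _ => Y) h y) ∂(κ' t h) ∂(chainLaw κ' t) :=
          ih (Measurable.lintegral_kernel_prod_right
            (f := fun h y => f t y * g (Fin.snoc (α := fun _ => Y) h y)) (by
              exact ((hf t).comp measurable_snd).mul hm))
      _ = _ := by
          refine lintegral_congr fun h => ?_
          have hmul : Measurable fun y => f t y * g (Fin.snoc (α := fun _ => Y) h y) :=
            (hf t).mul (hm.comp measurable_prodMk_left)
          rw [← lintegral_const_mul _ hmul]
          simp only [mul_assoc]

/-- The probability of an event that depends only on an initial segment of the rounds is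
determined by the kernels of those rounds. -/
theorem lintegral_chainLaw_congr {p : ℕ → Prop} (hp : ∀ s t, s ≤ t → p t → p s)
    (hκ : ∀ t, p t → κ t = κ' t) (t : ℕ) {g : (Fin t → Y) → ℝ≥0∞} (hg : Measurable g)
    (hgp : ∀ h h' : Fin t → Y, (∀ s : Fin t, p s → h s = h' s) → g h = g h') :
    ∫⁻ h, g h ∂(chainLaw κ t) = ∫⁻ h, g h ∂(chainLaw κ' t) := by
  have hlaw : ∀ t, (∀ s < t, p s) → chainLaw κ t = chainLaw κ' t := by
    intro t
    induction t with
    | zero => intro _; rfl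
    | succ t ih =>
      intro h
      rw [chainLaw, chainLaw, ih fun s hs => h s (by omega), hκ t (h t (by omega))]
  induction t with
  | zero => rfl
  | succ t ih =>
    by_cases hpt : p t
    · rw [hlaw (t + 1) fun s hs => hp s t (by omega) hpt]
    · have hne : Nonempty Y := by
        by_contra hY
        rw [not_nonempty_iff] at hY
        have : IsEmpty (Fin (t + 1) → Y) := ⟨fun h => hY.elim (h 0)⟩
        have h1 := measure_univ (μ := chainLaw κ (t + 1))
        rw [Set.univ_eq_empty_iff.2 this, measure_empty] at h1
        exact zero_ne_one h1
      obtain ⟨y₀⟩ := hne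
      have hc : ∀ (h : Fin t → Y) (y : Y), g (Fin.snoc (α := fun _ => Y) h y) =
          g (Fin.snoc (α := fun _ => Y) h y₀) := by
        refine fun h y => hgp _ _ fun s hs => ?_
        induction s using Fin.lastCases with
        | last => exact absurd hs hpt
        | cast s => simp
      have hm : Measurable fun h : Fin t → Y => g (Fin.snoc (α := fun _ => Y) h y₀) :=
        hg.comp ((measurable_snoc t).comp (measurable_id.prodMk measurable_const))
      rw [lintegral_chainLaw_succ κ t hg, lintegral_chainLaw_succ κ' t hg]
      simp only [hc, lintegral_const, measure_univ, mul_one]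
      refine ih hm fun h h' hh => hgp _ _ fun s hs => ?_
      induction s using Fin.lastCases with
      | last => simp
      | cast s => simpa using hh s hs

/-- Lower bound on the probability of an event under the alternative `κ'`. The log-likelihood
ratio of the two laws is bounded by `∑ (φ + ψ)`, where `φ` has conditional mean `m` and
exponential moments, handled by Chernoff's bound, and `ψ` is small in `L¹`, handled by Markov's
inequality. -/
theorem lintegral_chainLaw_change_of_measure {φ ψ m : ℕ → Y → ℝ}
    (hφ : ∀ t, Measurable (φ t)) (hψ : ∀ t, Measurable (ψ t)) (hm : ∀ t, Measurable (m t))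
    (hψ0 : ∀ t y, 0 ≤ ψ t y)
    (hκ : ∀ t h (g : Y → ℝ≥0∞), Measurable g →
      ∫⁻ y, g y ∂(κ t h) ≤ ∫⁻ y, ENNReal.ofReal (Real.exp (φ t y + ψ t y)) * g y ∂(κ' t h))
    {s δ η : ℝ} (hs : 0 < s) (hδ : 0 < δ)
    (hexp : ∀ t h, ∫⁻ y, ENNReal.ofReal (Real.exp (s * (φ t y - m t y - δ))) ∂(κ t h) ≤ 1)
    (hη : ∀ t h, ∫⁻ y, ENNReal.ofReal (ψ t y) ∂(κ t h) ≤ ENNReal.ofReal η)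
    {T : ℕ} (hT : 0 < T) {g : (Fin T → Y) → ℝ≥0∞} (hg : Measurable g) (hg1 : ∀ h, g h ≤ 1)
    {X : ℝ} (hX : ∀ h, g h ≠ 0 → ∑ t : Fin T, m t (h t) ≤ X) :
    ∫⁻ h, g h ∂(chainLaw κ T) ≤
      ENNReal.ofReal (Real.exp (X + 3 * T * δ)) * ∫⁻ h, g h ∂(chainLaw κ' T) +
        ENNReal.ofReal (Real.exp (-(s * T * δ))) + ENNReal.ofReal (η / δ) := by
  have hT0 : (0 : ℝ) < T := by exact_mod_cast hT
  have hTδ : 0 < T * δ := mul_pos hT0 hδ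
  let Φ (h : Fin T → Y) : ℝ := ∑ t : Fin T, (φ t (h t) + ψ t (h t))
  have hΦ : Measurable Φ := by fun_prop
  let g₁ (h : Fin T → Y) : ℝ≥0∞ := ENNReal.ofReal (Real.exp (-Φ h)) * g h
  let g₂ (h : Fin T → Y) : ℝ≥0∞ :=
    ∏ t : Fin T, ENNReal.ofReal (Real.exp (s * (φ t (h t) - m t (h t) - δ)))
  let g₃ (h : Fin T → Y) : ℝ≥0∞ := ∑ t : Fin T, ENNReal.ofReal (ψ t (h t))
  have hg₁ : Measurable g₁ := by fun_prop
  have hg₂ : Measurable g₂ := by fun_prop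
  have hg₃ : Measurable g₃ := by fun_prop
  have hpt : ∀ h, g h ≤ ENNReal.ofReal (Real.exp (X + 3 * T * δ)) * g₁ h +
      ENNReal.ofReal (Real.exp (-(s * T * δ))) * g₂ h +
        (ENNReal.ofReal (T * δ))⁻¹ * g₃ h := by
    intro h
    by_cases h0 : g h = 0
    · rw [h0]; exact zero_le
    have hXh := hX h h0
    have e3 : g₃ h = ENNReal.ofReal (∑ t : Fin T, ψ t (h t)) :=
      (ENNReal.ofReal_sum_of_nonneg fun t _ => hψ0 _ _).symm
    have e2 : g₂ h = ENNReal.ofReal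
        (Real.exp (s * (∑ t : Fin T, φ t (h t) - ∑ t : Fin T, m t (h t) - T * δ))) := by
      have : s * (∑ t : Fin T, φ t (h t) - ∑ t : Fin T, m t (h t) - T * δ) =
          ∑ t : Fin T, s * (φ t (h t) - m t (h t) - δ) := by
        rw [← Finset.mul_sum]
        simp [Finset.sum_sub_distrib]
      rw [this, Real.exp_sum, ENNReal.ofReal_prod_of_nonneg fun _ _ => Real.exp_nonneg _]
    by_cases c3 : T * δ < ∑ t : Fin T, ψ t (h t)
    · refine (hg1 h).trans (le_trans ?_ le_add_self)
      rw [e3, ← ENNReal.ofReal_inv_of_pos hTδ, ← ENNReal.ofReal_mul (by positivity),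
        ← ENNReal.ofReal_one]
      refine ENNReal.ofReal_le_ofReal ?_
      rw [inv_mul_eq_div, one_le_div hTδ]
      exact c3.le
    by_cases c2 : T * δ < ∑ t : Fin T, φ t (h t) - ∑ t : Fin T, m t (h t) - T * δ
    · refine (hg1 h).trans (le_trans ?_ (le_self_add))
      refine le_trans ?_ le_add_self
      rw [e2, ← ENNReal.ofReal_mul (Real.exp_nonneg _), ← Real.exp_add, ← ENNReal.ofReal_one]
      refine ENNReal.ofReal_le_ofReal (Real.one_le_exp ?_)
      nlinarith
    · refine le_trans ?_ (le_self_add.trans le_self_add)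
      rw [← mul_assoc, ← ENNReal.ofReal_mul (Real.exp_nonneg _), ← Real.exp_add]
      refine le_mul_of_one_le_left' ?_
      rw [ENNReal.one_le_ofReal, Real.one_le_exp_iff]
      have : Φ h = ∑ t : Fin T, φ t (h t) + ∑ t : Fin T, ψ t (h t) := Finset.sum_add_distrib
      rw [this]
      linarith
  have i1 : ∫⁻ h, g₁ h ∂(chainLaw κ T) ≤ ∫⁻ h, g h ∂(chainLaw κ' T) := by
    refine (lintegral_chainLaw_le_of_density κ κ' (by fun_prop) hκ T hg₁).trans (le_of_eq ?_)
    refine lintegral_congr fun h => ?_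
    have : ∏ t : Fin T, ENNReal.ofReal (Real.exp (φ t (h t) + ψ t (h t))) =
        ENNReal.ofReal (Real.exp (Φ h)) := by
      rw [Real.exp_sum, ENNReal.ofReal_prod_of_nonneg fun _ _ => Real.exp_nonneg _]
    rw [this, ← mul_assoc, ← ENNReal.ofReal_mul (Real.exp_nonneg _), ← Real.exp_add]
    simp
  have i2 : ∫⁻ h, g₂ h ∂(chainLaw κ T) ≤ 1 :=
    lintegral_chainLaw_prod_le_one κ (by fun_prop) hexp T
  have i3 : ∫⁻ h, g₃ h ∂(chainLaw κ T) ≤ T * ENNReal.ofReal η :=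
    lintegral_chainLaw_sum_le κ (by fun_prop) hη T
  refine (lintegral_mono hpt).trans ?_
  rw [lintegral_add_right _ (by fun_prop), lintegral_add_right _ (by fun_prop),
    lintegral_const_mul _ hg₁, lintegral_const_mul _ hg₂, lintegral_const_mul _ hg₃]
  refine add_le_add (add_le_add (mul_le_mul_right i1 _) (mul_le_of_le_one_right' i2)) ?_
  refine (mul_le_mul_right i3 _).trans (le_of_eq ?_)
  rw [← ENNReal.ofReal_inv_of_pos hTδ, ← ENNReal.ofReal_natCast, ← ENNReal.ofReal_mul hT0.le,
    ← ENNReal.ofReal_mul (by positivity)]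
  congr 1
  field_simp

end Chain

/-- Decomposition of the log-likelihood ratio of two distributions with finite divergence: it is
bounded by `φ + ψ`, where `φ` is bounded with mean about `D(Q ‖ P)`, and `ψ` is small in `L¹(Q)`. -/
theorem exists_llr_bound {Ω : Type*} [MeasurableSpace Ω] (Q P : Measure Ω)
    [IsProbabilityMeasure Q] [IsProbabilityMeasure P]
    (h : klDiv Q P ≠ ⊤) {δ η : ℝ} (hδ : 0 < δ) (hη : 0 < η) :
    ∃ φ ψ : Ω → ℝ, Measurable φ ∧ Measurable ψ ∧ (∀ x, 0 ≤ ψ x) ∧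
      (∀ g : Ω → ℝ≥0∞, Measurable g →
        ∫⁻ x, g x ∂Q ≤ ∫⁻ x, ENNReal.ofReal (Real.exp (φ x + ψ x)) * g x ∂P) ∧
      ∫⁻ x, ENNReal.ofReal (ψ x) ∂Q ≤ ENNReal.ofReal η ∧
      ∀ᶠ s in nhdsWithin (0 : ℝ) (Set.Ioi 0),
        ∫⁻ x, ENNReal.ofReal (Real.exp (s * (φ x - (klDiv Q P).toReal - δ))) ∂Q ≤ 1 := by
  obtain ⟨hac, hint⟩ := klDiv_ne_top_iff.1 h
  have hη' : 0 < min η (δ / 2) := lt_min hη (by positivity)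
  obtain ⟨φ, hφ, hφL⟩ := (memLp_one_iff_integrable.2 hint).exists_simpleFunc_eLpNorm_sub_lt
    ENNReal.one_ne_top (ε := ENNReal.ofReal (min η (δ / 2))) (by simpa using hη')
  have hφI : Integrable φ Q := memLp_one_iff_integrable.1 hφL
  have hψm : Measurable fun x => |llr Q P x - φ x| :=
    ((measurable_llr Q P).sub φ.measurable).abs
  have hψI : Integrable (fun x => |llr Q P x - φ x|) Q := (hint.sub hφI).abs
  have hψ1 : ∫⁻ x, ENNReal.ofReal |llr Q P x - φ x| ∂Q ≤ ENNReal.ofReal (min η (δ / 2)) := by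
    refine le_trans (le_of_eq ?_) hφ.le
    rw [eLpNorm_one_eq_lintegral_enorm]
    refine lintegral_congr fun x => ?_
    rw [← Real.enorm_eq_ofReal_abs]
    rfl
  refine ⟨φ, fun x => |llr Q P x - φ x|, φ.measurable, hψm, fun x => abs_nonneg _, ?_,
    hψ1.trans (ENNReal.ofReal_le_ofReal (min_le_left _ _)), ?_⟩
  · intro g hg
    have e : Q = P.withDensity (Q.rnDeriv P) := (Measure.withDensity_rnDeriv_eq Q P hac).symm
    conv_lhs => rw [e]
    rw [lintegral_withDensity_eq_lintegral_mul _ (Measure.measurable_rnDeriv Q P) hg]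
    refine lintegral_mono_ae ?_
    filter_upwards [Measure.rnDeriv_ne_top Q P] with x hx
    refine mul_le_mul_left ?_ _
    rw [← ENNReal.ofReal_toReal hx]
    refine ENNReal.ofReal_le_ofReal ?_
    calc (Q.rnDeriv P x).toReal ≤ Real.exp (llr Q P x) := by
          rw [llr]
          rcases (ENNReal.toReal_nonneg (a := Q.rnDeriv P x)).eq_or_lt with h0 | h0
          · rw [← h0]; positivity
          · rw [Real.exp_log h0]
      _ ≤ _ := Real.exp_le_exp.2 (by linarith [le_abs_self (llr Q P x - φ x)])
  · set D := (klDiv Q P).toReal with hD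
    have hDint : D = ∫ x, llr Q P x ∂Q := by
      rw [hD, toReal_klDiv_of_measure_eq hac (by simp)]
    have hφD : ∫ x, φ x ∂Q ≤ D + δ / 2 := by
      have h1 : ∫ x, |llr Q P x - φ x| ∂Q ≤ δ / 2 := by
        rw [integral_eq_lintegral_of_nonneg_ae (Eventually.of_forall fun x => abs_nonneg _)
          hψm.aestronglyMeasurable]
        refine ENNReal.toReal_le_of_le_ofReal (by positivity)
          (hψ1.trans (ENNReal.ofReal_le_ofReal (min_le_right _ _)))
      have h2 : ∫ x, φ x ∂Q ≤ ∫ x, (llr Q P x + |llr Q P x - φ x|) ∂Q := by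
        refine integral_mono hφI (hint.add hψI) fun x => ?_
        have := neg_abs_le (llr Q P x - φ x)
        simp only
        linarith
      rw [integral_add hint hψI, ← hDint] at h2
      linarith
    -- a bound on the simple function `φ - D - δ`
    obtain ⟨C, hC⟩ : ∃ C : ℝ, ∀ x, |φ x - D - δ| ≤ C := by
      obtain ⟨C, hC⟩ := (φ.map fun y => |y - D - δ|).finite_range.bddAbove
      exact ⟨C, fun x => hC ⟨x, rfl⟩⟩
    have hC0 : 0 ≤ C := by
      obtain ⟨x⟩ : Nonempty Ω := nonempty_of_isProbabilityMeasure Q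
      exact (abs_nonneg _).trans (hC x)
    have hpos : 0 < min (1 / (C + 1)) (δ / (2 * (C ^ 2 + 1))) := by positivity
    filter_upwards [Ioo_mem_nhdsGT hpos] with s hs
    have hs0 : 0 < s := hs.1
    have hs1 : s * (C + 1) < 1 := by
      have := hs.2.trans_le (min_le_left _ _)
      rwa [lt_div_iff₀ (by positivity)] at this
    have hs2 : s * (2 * (C ^ 2 + 1)) < δ := by
      have := hs.2.trans_le (min_le_right _ _)
      rwa [lt_div_iff₀ (by positivity)] at this
    have hYI : Integrable (fun x => φ x - D - δ) Q :=
      (hφI.sub (integrable_const _)).sub (integrable_const _)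
    -- `exp u ≤ 1 + u + u²` for `|u| ≤ 1`
    have hle : ∀ x, Real.exp (s * (φ x - D - δ)) ≤
        1 + s * (φ x - D - δ) + s ^ 2 * C ^ 2 := by
      intro x
      have h1 : |s * (φ x - D - δ)| ≤ s * C := by
        rw [abs_mul, abs_of_pos hs0]
        exact mul_le_mul_of_nonneg_left (hC x) hs0.le
      have h2 := Real.abs_exp_sub_one_sub_id_le (x := s * (φ x - D - δ)) (by nlinarith)
      have h3 : (s * (φ x - D - δ)) ^ 2 ≤ s ^ 2 * C ^ 2 := by
        rw [← mul_pow, ← sq_abs]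
        gcongr
      have := le_abs_self (Real.exp (s * (φ x - D - δ)) - 1 - s * (φ x - D - δ))
      linarith
    have hnn : ∀ x, 0 ≤ 1 + s * (φ x - D - δ) + s ^ 2 * C ^ 2 :=
      fun x => (Real.exp_nonneg _).trans (hle x)
    have hI2 : Integrable (fun x => 1 + s * (φ x - D - δ) + s ^ 2 * C ^ 2) Q :=
      ((integrable_const _).add (hYI.const_mul s)).add (integrable_const _)
    refine (lintegral_mono fun x => ENNReal.ofReal_le_ofReal (hle x)).trans ?_
    have hval : ∫ x, (1 + s * (φ x - D - δ) + s ^ 2 * C ^ 2) ∂Q =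
        s * ∫ x, φ x ∂Q + (1 - s * (D + δ) + s ^ 2 * C ^ 2) := by
      have : ∀ x, 1 + s * (φ x - D - δ) + s ^ 2 * C ^ 2 =
          s * φ x + (1 - s * (D + δ) + s ^ 2 * C ^ 2) := fun x => by ring
      simp_rw [this]
      rw [integral_add (hφI.const_mul s) (integrable_const _), integral_const_mul]
      simp
    rw [← ofReal_integral_eq_lintegral_ofReal hI2 (Eventually.of_forall hnn),
      ENNReal.ofReal_le_one, hval]
    nlinarith

/-! ### Causal choices and pigeonhole for limits -/

/-- Extension of a causal choice, one index at a time: if `good n` depends only on the first `n`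
entries, and a good choice for the first `n` entries can always be extended, then good choices
can be made by functions of the entries seen so far. -/
theorem exists_causal_choice {B : ℕ} {X C : Type*} [Nonempty C]
    (good : ℕ → (Fin B → X) → (Fin B → C) → Prop) (h0 : ∀ x c, good 0 x c)
    (hdep : ∀ n x x' c c', (∀ b : Fin B, b.1 < n → x b = x' b) →
      (∀ b : Fin B, b.1 < n → c b = c' b) → good n x c → good n x' c')
    (hstep : ∀ n (hn : n < B) x c, good n x c → ∃ v, good (n + 1) x (Function.update c ⟨n, hn⟩ v)) :
    ∃ f : (b : Fin B) → (Fin (b.1 + 1) → X) → C,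
      ∀ x, good B x fun b => f b fun a => x (Fin.castLE b.2 a) := by
  suffices h : ∀ n ≤ B, ∃ f : (b : Fin B) → (Fin (b.1 + 1) → X) → C,
      ∀ x, good n x fun b => f b fun a => x (Fin.castLE b.2 a) from h B le_rfl
  intro n
  induction n with
  | zero => exact fun _ => ⟨fun _ _ => Classical.arbitrary C, fun x => h0 _ _⟩
  | succ n ih =>
    intro hn
    obtain ⟨f, hf⟩ := ih (by omega)
    -- extend a sequence of length `n + 1` by its last entry
    let ext (y : Fin (n + 1) → X) : Fin B → X := fun b => y ⟨min b.1 n, by omega⟩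
    choose v hv using fun y => hstep n hn (ext y) _ (hf (ext y))
    refine ⟨Function.update f ⟨n, hn⟩ v, fun x => ?_⟩
    refine hdep (n + 1) _ _ _ _ ?_ ?_ (hv fun a => x (Fin.castLE hn a))
    · intro b hb
      refine congrArg x (Fin.ext ?_)
      simp only [Fin.val_castLE]
      omega
    · intro b hb
      by_cases hbn : b = ⟨n, hn⟩
      · subst hbn
        simp
      · have hlt : b.1 < n := by
          have : b.1 ≠ n := fun h => hbn (Fin.ext h)
          omega
        rw [Function.update_of_ne hbn, Function.update_of_ne hbn]
        congr 1
        funext a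
        refine congrArg x (Fin.ext ?_)
        have := a.2
        simp only [Fin.val_castLE]
        omega

theorem exists_not_tendsto_zero {ι : Type*} [Fintype ι] {u : ℕ → ℝ≥0∞} {w : ι → ℕ → ℝ≥0∞}
    (hle : ∀ T, u T ≤ ∑ i, w i T) (hu : ¬Tendsto u atTop (nhds 0)) :
    ∃ i, ¬Tendsto (w i) atTop (nhds 0) := by
  by_contra! hw
  refine hu (tendsto_of_tendsto_of_tendsto_of_le_of_le tendsto_const_nhds ?_
    (fun _ => zero_le) hle)
  simpa using tendsto_finsetSum Finset.univ fun i _ => hw i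

/-! ### Algorithms in a batchwise changing environment -/

namespace BanditAlg

variable {K T : ℕ}

instance (π : BanditAlg K T) (t : ℕ) : IsMarkovKernel (π.sample t) := π.sample_markov t

instance (π : BanditAlg K T) : IsMarkovKernel π.recommend := π.recommend_markov

instance (P : Fin K → ProbabilityMeasure ℝ) : IsMarkovKernel (armKernel P) :=
  ⟨fun i => (P i).2⟩

/-- The kernel that draws the next (arm, reward) pair when the reward distributions in round `t`
are `ν t`. -/
noncomputable def envKernel (π : BanditAlg K T) (ν : ℕ → Fin K → ProbabilityMeasure ℝ) (t : ℕ) :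
    Kernel (Fin t → Fin K × ℝ) (Fin K × ℝ) :=
  π.sample t ⊗ₖ Kernel.prodMkLeft (Fin t → Fin K × ℝ) (armKernel (ν t))

instance (π : BanditAlg K T) (ν : ℕ → Fin K → ProbabilityMeasure ℝ) (t : ℕ) :
    IsMarkovKernel (π.envKernel ν t) := by
  unfold envKernel; infer_instance

theorem lintegral_envKernel (π : BanditAlg K T) (ν : ℕ → Fin K → ProbabilityMeasure ℝ) (t : ℕ)
    (h : Fin t → Fin K × ℝ) {g : Fin K × ℝ → ℝ≥0∞} (hg : Measurable g) :
    ∫⁻ y, g y ∂(π.envKernel ν t h) =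
      ∫⁻ i, ∫⁻ x, g (i, x) ∂(ν t i : Measure ℝ) ∂(π.sample t h) := by
  rw [envKernel, Kernel.lintegral_compProd _ _ _ hg]
  rfl

theorem lintegral_envKernel_le (π : BanditAlg K T) (ν : ℕ → Fin K → ProbabilityMeasure ℝ) (t : ℕ)
    (h : Fin t → Fin K × ℝ) {g : Fin K × ℝ → ℝ≥0∞} (hg : Measurable g) {c : ℝ≥0∞}
    (hc : ∀ i, ∫⁻ x, g (i, x) ∂(ν t i : Measure ℝ) ≤ c) :
    ∫⁻ y, g y ∂(π.envKernel ν t h) ≤ c := by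
  rw [lintegral_envKernel π ν t h hg]
  refine (lintegral_mono hc).trans ?_
  simp

theorem historyLaw_eq_chainLaw (π : BanditAlg K T) (P : Fin K → ProbabilityMeasure ℝ) (t : ℕ) :
    π.historyLaw P t = chainLaw (π.envKernel fun _ => P) t := by
  induction t with
  | zero => rfl
  | succ t ih => rw [historyLaw, chainLaw, ih]; rfl

theorem lintegral_recommend_le_errorProb (π : BanditAlg K T) (P : Fin K → ProbabilityMeasure ℝ)
    {j : Fin K} (hj : j ∉ bestArms P) :
    ∫⁻ h, π.recommend h {j} ∂(chainLaw (π.envKernel fun _ => P) T) ≤ π.errorProb P := by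
  rw [errorProb, Measure.bind_apply (Set.toFinite _).measurableSet π.recommend.aemeasurable,
    historyLaw_eq_chainLaw]
  exact lintegral_mono fun h => measure_mono (by simpa using hj)

end BanditAlg

section Batches

variable {K B : ℕ} [NeZero B]

/-- The batch of round `t` when `T` rounds are cut into `B` batches of length `T / B + 1`; the
last batches may be shorter, or empty. Rounds from `T` on, which do not matter, may be counted to
the last batch. -/
def batchIdx (B : ℕ) [NeZero B] (T t : ℕ) : Fin B :=
  ⟨min (t / (T / B + 1)) (B - 1), by have := NeZero.pos B; omega⟩

/-- The number of draws of arm `i` in batch `b`. -/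
noncomputable def batchCount (T : ℕ) (b : Fin B) (i : Fin K) (h : Fin T → Fin K × ℝ) : ℝ :=
  ∑ t : Fin T, if batchIdx B T t = b ∧ (h t).1 = i then 1 else 0

theorem measurable_batchCount (T : ℕ) (b : Fin B) (i : Fin K) :
    Measurable (batchCount T b i : (Fin T → Fin K × ℝ) → ℝ) := by
  refine Finset.measurable_sum _ fun t _ => ?_
  refine Measurable.ite ?_ measurable_const measurable_const
  refine MeasurableSet.inter (MeasurableSet.const _) ?_
  exact (measurable_fst.comp (measurable_pi_apply t)) (measurableSet_singleton i)

theorem batchIdx_mono {T s t : ℕ} (h : s ≤ t) : (batchIdx B T s).1 ≤ (batchIdx B T t).1 :=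
  min_le_min_right _ (Nat.div_le_div_right h)

theorem card_batch_le (T : ℕ) (b : Fin B) :
    (∑ t : Fin T, if batchIdx B T t = b then (1 : ℝ) else 0) ≤ (T / B + 1 : ℕ) := by
  have hB := NeZero.pos B
  have hL : 0 < T / B + 1 := Nat.succ_pos _
  rw [Fin.sum_univ_eq_sum_range (fun t => if batchIdx B T t = b then (1 : ℝ) else 0),
    Finset.sum_boole]
  norm_cast
  have hsub : (Finset.range T).filter (fun t => batchIdx B T t = b) ⊆
      Finset.Ico (b.1 * (T / B + 1)) ((b.1 + 1) * (T / B + 1)) := by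
    intro t ht
    simp only [Finset.mem_filter, Finset.mem_range] at ht
    have hlt : t / (T / B + 1) < B := by
      rw [Nat.div_lt_iff_lt_mul hL]
      exact ht.1.trans (Nat.lt_mul_div_succ T hB)
    have hb : t / (T / B + 1) = b.1 := by
      rw [← ht.2, batchIdx]
      simp only
      omega
    rw [Finset.mem_Ico, ← Nat.le_div_iff_mul_le hL, ← Nat.div_lt_iff_lt_mul hL]
    omega
  refine (Finset.card_le_card hsub).trans ?_
  rw [Nat.card_Ico, ← Nat.sub_mul]
  simp

theorem sum_batchCount (T : ℕ) (b : Fin B) (h : Fin T → Fin K × ℝ) :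
    ∑ i, batchCount T b i h = ∑ t : Fin T, if batchIdx B T t = b then (1 : ℝ) else 0 := by
  simp only [batchCount]
  rw [Finset.sum_comm]
  refine Finset.sum_congr rfl fun t _ => ?_
  by_cases hb : batchIdx B T t = b <;> simp [hb]

theorem batchCount_nonneg (T : ℕ) (b : Fin B) (i : Fin K) (h : Fin T → Fin K × ℝ) :
    0 ≤ batchCount T b i h :=
  Finset.sum_nonneg fun t _ => by split_ifs <;> norm_num

theorem sum_eq_sum_batchCount (T : ℕ) (D : Fin B → Fin K → ℝ) (h : Fin T → Fin K × ℝ) :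
    ∑ t : Fin T, D (batchIdx B T t) (h t).1 = ∑ b, ∑ i, batchCount T b i h * D b i := by
  simp only [batchCount, Finset.sum_mul, ite_mul, one_mul, zero_mul]
  rw [Finset.sum_congr rfl fun b _ => Finset.sum_comm, Finset.sum_comm]
  refine Finset.sum_congr rfl fun t _ => ?_
  symm
  rw [Finset.sum_eq_single (batchIdx B T t)]
  · simp
  · intro b _ hb
    simp [hb.symm]
  · simp

/-- The histories whose empirical allocation in each of the first `n` batches `b` exceeds `c b` by
at most `ε` in every coordinate. -/
def trackEvent (T : ℕ) (ε : ℝ) (n : ℕ) (c : Fin B → stdSimplex ℝ (Fin K)) :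
    Set (Fin T → Fin K × ℝ) :=
  {h | ∀ b : Fin B, b.1 < n → ∀ i, batchCount T b i h ≤ ((c b).1 i + ε) * (T / B + 1 : ℕ)}

theorem measurableSet_trackEvent (T : ℕ) (ε : ℝ) (n : ℕ) (c : Fin B → stdSimplex ℝ (Fin K)) :
    MeasurableSet (trackEvent T ε n c) := by
  have : trackEvent T ε n c = ⋂ b : Fin B, ⋂ _ : b.1 < n, ⋂ i : Fin K,
      {h | batchCount T b i h ≤ ((c b).1 i + ε) * (T / B + 1 : ℕ)} := by
    ext h; simp [trackEvent]
  rw [this]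
  exact MeasurableSet.iInter fun b => MeasurableSet.iInter fun _ => MeasurableSet.iInter fun i =>
    measurableSet_le (measurable_batchCount T b i) measurable_const

/-- Every empirical allocation is close to an element of a finite net of the simplex. -/
theorem exists_mem_net {C : Type*} {val : C → stdSimplex ℝ (Fin K)} {ε : ℝ} (hε : 0 < ε)
    [Nonempty C]
    (hcov : ∀ x ∈ stdSimplex ℝ (Fin K), ∃ v, ∀ i, x i ≤ (val v).1 i + ε) (T : ℕ) (b : Fin B)
    (h : Fin T → Fin K × ℝ) :
    ∃ v, ∀ i, batchCount T b i h ≤ ((val v).1 i + ε) * (T / B + 1 : ℕ) := by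
  set len := ∑ i, batchCount T b i h with hlen
  have hle : len ≤ (T / B + 1 : ℕ) := by
    rw [hlen, sum_batchCount]
    exact card_batch_le T b
  have hnn := fun i => batchCount_nonneg T b i h
  rcases (Finset.sum_nonneg fun i _ => hnn i : 0 ≤ len).eq_or_lt with h0 | h0
  · obtain ⟨v⟩ := ‹Nonempty C›
    refine ⟨v, fun i => ?_⟩
    rw [(Finset.sum_eq_zero_iff_of_nonneg fun i _ => hnn i).1 h0.symm i (Finset.mem_univ i)]
    have := (val v).2.1 i
    positivity
  · obtain ⟨v, hv⟩ := hcov (fun i => batchCount T b i h / len)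
      ⟨fun i => div_nonneg (hnn i) h0.le, by rw [← Finset.sum_div, ← hlen, div_self h0.ne']⟩
    refine ⟨v, fun i => ?_⟩
    have h1 := (div_le_iff₀ h0).1 (hv i)
    have h2 := (val v).2.1 i
    exact h1.trans (mul_le_mul_of_nonneg_left hle (by linarith))

/-- The law of the history when the reward distributions in batch `b` are `Q b`. -/
noncomputable def batchLaw {T : ℕ} (π : BanditAlg K T) (Q : Fin B → Fin K → ProbabilityMeasure ℝ) :
    Measure (Fin T → Fin K × ℝ) :=
  chainLaw (π.envKernel fun t => Q (batchIdx B T t)) T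

instance {T : ℕ} (π : BanditAlg K T) (Q : Fin B → Fin K → ProbabilityMeasure ℝ) :
    IsProbabilityMeasure (batchLaw π Q) := by
  unfold batchLaw; infer_instance

theorem batchLaw_trackEvent_congr {T : ℕ} (π : BanditAlg K T) (ε : ℝ) (n : ℕ)
    {Q Q' : Fin B → Fin K → ProbabilityMeasure ℝ} {c c' : Fin B → stdSimplex ℝ (Fin K)}
    (hQ : ∀ b : Fin B, b.1 < n → Q b = Q' b) (hc : ∀ b : Fin B, b.1 < n → c b = c' b) :
    batchLaw π Q (trackEvent T ε n c) = batchLaw π Q' (trackEvent T ε n c') := by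
  have hE : trackEvent T ε n c = trackEvent T ε n c' := by
    ext h
    refine forall_congr' fun b => forall_congr' fun hb => ?_
    rw [hc b hb]
  have hm := measurableSet_trackEvent T ε n c'
  rw [hE, ← lintegral_indicator_one hm, ← lintegral_indicator_one hm]
  refine lintegral_chainLaw_congr _ _ (p := fun t => (batchIdx B T t).1 < n)
    (fun s t hst ht => (batchIdx_mono hst).trans_lt ht) ?_ T (measurable_one.indicator hm) ?_
  · intro t ht
    rw [BanditAlg.envKernel, BanditAlg.envKernel, hQ _ ht]
  · intro h h' hh
    have hcount : ∀ b : Fin B, b.1 < n → ∀ i, batchCount T b i h = batchCount T b i h' := by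
      refine fun b hb i => Finset.sum_congr rfl fun t _ => ?_
      by_cases htb : batchIdx B T t = b
      · rw [hh t (by simpa [htb] using hb)]
      · simp [htb]
    have : h ∈ trackEvent T ε n c' ↔ h' ∈ trackEvent T ε n c' := by
      refine forall_congr' fun b => forall_congr' fun hb => forall_congr' fun i => ?_
      rw [hcount b hb i]
    by_cases hmem : h ∈ trackEvent T ε n c'
    · rw [Set.indicator_of_mem hmem, Set.indicator_of_mem (this.1 hmem)]
      rfl
    · rw [Set.indicator_of_notMem hmem, Set.indicator_of_notMem (mt this.2 hmem)]

/-! ### Typical allocations -/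

theorem exists_finite_net (hK : 1 ≤ K) {ε : ℝ} (hε : 0 < ε) :
    ∃ C : Finset (stdSimplex ℝ (Fin K)), C.Nonempty ∧
      ∀ x ∈ stdSimplex ℝ (Fin K), ∃ v : C, ∀ i, x i ≤ v.1.1 i + ε := by
  obtain ⟨t, -, htf, ht⟩ := finite_cover_balls_of_compact
    (isCompact_univ (X := stdSimplex ℝ (Fin K))) hε
  have hcov : ∀ x ∈ stdSimplex ℝ (Fin K), ∃ v ∈ htf.toFinset, ∀ i, x i ≤ v.1 i + ε := by
    intro x hx
    obtain ⟨v, hv, hd⟩ := Set.mem_iUnion₂.1 (ht (Set.mem_univ (⟨x, hx⟩ : stdSimplex ℝ (Fin K))))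
    refine ⟨v, by simpa using hv, fun i => ?_⟩
    have h1 : dist (x i) (v.1 i) ≤ dist x v.1 := dist_le_pi_dist x v.1 i
    have h2 : dist x v.1 < ε := hd
    have h3 := le_abs_self (x i - v.1 i)
    rw [Real.dist_eq] at h1
    linarith
  refine ⟨htf.toFinset, ?_, fun x hx => ?_⟩
  · obtain ⟨v, hv, -⟩ := hcov _ (single_mem_stdSimplex ℝ (⟨0, hK⟩ : Fin K))
    exact ⟨v, hv⟩
  · obtain ⟨v, hv, h⟩ := hcov x hx
    exact ⟨⟨v, hv⟩, h⟩

/-- For every sequence of algorithms there are causal allocation rules and a recommendation rule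
such that, in every batchwise constant environment `Q`, the event that the algorithm follows the
allocations up to `ε` and recommends `J Q` has probability that does not tend to zero. -/
theorem exists_typical_rules (hK : 1 ≤ K) (π : (T : ℕ) → BanditAlg K T) {ε : ℝ} (hε : 0 < ε) :
    ∃ (r : (b : Fin B) → (Fin (b.1 + 1) → Fin K → ProbabilityMeasure ℝ) → stdSimplex ℝ (Fin K))
      (J : (Fin B → Fin K → ProbabilityMeasure ℝ) → Fin K),
      ∀ Q : Fin B → Fin K → ProbabilityMeasure ℝ,
        ¬Tendsto (fun T => ∫⁻ h in trackEvent T ε B fun b => r b fun a => Q (Fin.castLE b.2 a),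
          (π T).recommend h {J Q} ∂(batchLaw (π T) Q)) atTop (nhds 0) := by
  obtain ⟨C, ⟨v₀, hv₀⟩, hcov⟩ := exists_finite_net hK hε
  have : Nonempty C := ⟨⟨v₀, hv₀⟩⟩
  let good (n : ℕ) (Q : Fin B → Fin K → ProbabilityMeasure ℝ) (c : Fin B → C) : Prop :=
    ¬Tendsto (fun T => batchLaw (π T) Q (trackEvent T ε n fun b => (c b).1)) atTop (nhds 0)
  obtain ⟨f, hf⟩ := exists_causal_choice good (fun Q c => by
      have : ∀ T, trackEvent T ε 0 (fun b => (c b).1) = (Set.univ : Set (Fin T → Fin K × ℝ)) :=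
        fun T => Set.eq_univ_of_forall fun h b hb => absurd hb (Nat.not_lt_zero _)
      intro h
      simp only [this, measure_univ] at h
      exact one_ne_zero (tendsto_nhds_unique tendsto_const_nhds h)) (fun n Q Q' c c' hQ hc hg => by
      have hcc : ∀ b : Fin B, b.1 < n → (c b).1 = (c' b).1 := fun b hb => by rw [hc b hb]
      simpa only [good, fun T => batchLaw_trackEvent_congr (π T) ε n hQ hcc] using hg)
    (fun n hn Q c hg => by
      refine exists_not_tendsto_zero (fun T => ?_) hg
      refine (measure_mono fun h hh => ?_).trans (measure_iUnion_fintype_le _ _)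
      obtain ⟨v, hv⟩ := exists_mem_net (val := fun v : C => v.1) hε hcov T (⟨n, hn⟩ : Fin B) h
      refine Set.mem_iUnion.2 ⟨v, fun b hb i => ?_⟩
      by_cases hbn : b = ⟨n, hn⟩
      · subst hbn
        simpa using hv i
      · have hlt : b.1 < n := by
          have : b.1 ≠ n := fun h => hbn (Fin.ext h)
          omega
        simpa [Function.update_of_ne hbn] using hh b hlt i)
  have hJ : ∀ Q : Fin B → Fin K → ProbabilityMeasure ℝ, ∃ j, ¬Tendsto (fun T =>
      ∫⁻ h in trackEvent T ε B fun b => (f b fun a => Q (Fin.castLE b.2 a)).1,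
        (π T).recommend h {j} ∂(batchLaw (π T) Q)) atTop (nhds 0) := by
    intro Q
    refine exists_not_tendsto_zero (fun T => ?_) (hf Q)
    rw [← lintegral_finsetSum _ fun j _ =>
      (π T).recommend.measurable_coe (measurableSet_singleton j)]
    have : ∀ h, ∑ j, (π T).recommend h {j} = 1 := fun h => by
      rw [sum_measure_singleton]
      simp
    simp [this]
  choose J hJ using hJ
  exact ⟨fun b x => (f b x).1, J, hJ⟩

end Batches

/-! ### The upper bound on the rate -/

section UpperBound

variable {K B : ℕ} [NeZero B]

/-- Change of measure from a batchwise constant environment `Q` to the stationary environment `P`,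
on the event that the allocations `c` are followed up to `ε`: if that event together with the
recommendation of `j` does not become improbable under `Q`, then the recommendation of `j` decays
under `P` at a rate that the divergences limit. -/
theorem frequently_le_errorProb (π : (T : ℕ) → BanditAlg K T) {ε : ℝ} (hε : 0 < ε)
    {c : Fin B → stdSimplex ℝ (Fin K)} {j : Fin K} {Q : Fin B → Fin K → ProbabilityMeasure ℝ}
    {P : Fin K → ProbabilityMeasure ℝ} (hj : j ∉ bestArms P) (hD : ∀ b i, KL (Q b i) (P i) ≠ ⊤)
    (hQ : ¬Tendsto (fun T => ∫⁻ h in trackEvent T ε B c,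
      (π T).recommend h {j} ∂(batchLaw (π T) Q)) atTop (nhds 0)) {δ : ℝ} (hδ : 0 < δ) :
    ∃ a > 0, ∃ᶠ T : ℕ in atTop, ENNReal.ofReal
      (a * Real.exp (-((∑ b, ∑ i, ((c b).1 i + ε) * (KL (Q b i) (P i)).toReal) * (T / B + 1) +
        3 * T * δ))) ≤ (π T).errorProb P := by
  set S := ∑ b, ∑ i, ((c b).1 i + ε) * (KL (Q b i) (P i)).toReal with hS
  -- a constant that the probability under `Q` exceeds infinitely often
  obtain ⟨a, ha, hfreq⟩ : ∃ a > 0, ∃ᶠ T : ℕ in atTop, ENNReal.ofReal a <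
      ∫⁻ h in trackEvent T ε B c, (π T).recommend h {j} ∂(batchLaw (π T) Q) := by
    rw [ENNReal.tendsto_nhds_zero] at hQ
    push Not at hQ
    obtain ⟨a, ha, hf⟩ := hQ
    have h1 : min a 1 ≠ ⊤ := ne_top_of_le_ne_top ENNReal.one_ne_top (min_le_right _ _)
    refine ⟨(min a 1).toReal, ENNReal.toReal_pos (lt_min ha one_pos).ne' h1, hf.mono fun T hT => ?_⟩
    rw [ENNReal.ofReal_toReal h1]
    exact (min_le_left _ _).trans_lt hT
  choose φ ψ hφ hψ hψ0 hdens hη hs using fun b i =>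
    exists_llr_bound (Q b i : Measure ℝ) (P i : Measure ℝ) (hD b i) hδ
      (show 0 < δ * (a / 4) by positivity)
  obtain ⟨s, hs0, hs1⟩ : ∃ s : ℝ, 0 < s ∧ ∀ b i, ∫⁻ x, ENNReal.ofReal
      (Real.exp (s * (φ b i x - (KL (Q b i) (P i)).toReal - δ))) ∂(Q b i : Measure ℝ) ≤ 1 := by
    have := (eventually_all.2 fun b => eventually_all.2 (hs b)).and self_mem_nhdsWithin
    obtain ⟨s, h1, h2⟩ := this.exists
    exact ⟨s, h2, h1⟩
  have hexp : ∀ᶠ T : ℕ in atTop, Real.exp (-(s * T * δ)) ≤ a / 4 := by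
    have h1 : Tendsto (fun T : ℕ => (s * δ) * (T : ℝ)) atTop atTop :=
      tendsto_natCast_atTop_atTop.const_mul_atTop (by positivity)
    have h2 := (Real.tendsto_exp_neg_atTop_nhds_zero.comp h1).eventually_le_const
      (show (0 : ℝ) < a / 4 by positivity)
    filter_upwards [h2] with T hT
    simpa [mul_right_comm] using hT
  refine ⟨a / 2, by positivity, ?_⟩
  refine (hfreq.and_eventually (hexp.and (eventually_gt_atTop 0))).mono ?_
  rintro T ⟨hT, hTe, hT0⟩
  have hmE := measurableSet_trackEvent T ε B c
  have hmJ : Measurable fun h => (π T).recommend h {j} :=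
    (π T).recommend.measurable_coe (measurableSet_singleton j)
  have hmeas : ∀ {f : Fin B → Fin K → ℝ → ℝ}, (∀ b i, Measurable (f b i)) →
      ∀ t, Measurable fun y : Fin K × ℝ => f (batchIdx B T t) y.1 y.2 := fun hf t =>
    measurable_from_prod_countable_right fun i => hf (batchIdx B T t) i
  set g : (Fin T → Fin K × ℝ) → ℝ≥0∞ :=
    (trackEvent T ε B c).indicator fun h => (π T).recommend h {j} with hg
  have hSX : ∀ h, g h ≠ 0 → ∑ t : Fin T, (KL (Q (batchIdx B T t) (h t).1) (P (h t).1)).toReal ≤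
      S * (T / B + 1) := by
    intro h h0
    have hh : ∀ b : Fin B, b.1 < B → ∀ i, batchCount T b i h ≤ ((c b).1 i + ε) * (T / B + 1 : ℕ) :=
      Set.mem_of_indicator_ne_zero h0
    rw [sum_eq_sum_batchCount T (fun b i => (KL (Q b i) (P i)).toReal), hS, Finset.sum_mul]
    refine Finset.sum_le_sum fun b _ => ?_
    rw [Finset.sum_mul]
    refine Finset.sum_le_sum fun i _ => ?_
    rw [mul_right_comm]
    refine mul_le_mul_of_nonneg_right ((hh b b.2 i).trans ?_) ENNReal.toReal_nonneg
    have h1 := (c b).2.1 i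
    have h2 : ((T / B + 1 : ℕ) : ℝ) ≤ T / B + 1 := by
      push_cast
      gcongr
      exact Nat.cast_div_le
    exact mul_le_mul_of_nonneg_left h2 (by linarith)
  have key := lintegral_chainLaw_change_of_measure
    ((π T).envKernel fun t => Q (batchIdx B T t)) ((π T).envKernel fun _ => P)
    (hmeas hφ) (hmeas hψ) (hmeas (f := fun b i _ => (KL (Q b i) (P i)).toReal) fun b i =>
      measurable_const) (fun t y => hψ0 _ _ _) (fun t h f hf => ?_) hs0 hδ (fun t h => ?_)
    (η := δ * (a / 4)) (fun t h => ?_) hT0 (hmJ.indicator hmE) (fun h => ?_) hSX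
  rotate_left
  · have hw : Measurable fun y : Fin K × ℝ => ENNReal.ofReal (Real.exp
        (φ (batchIdx B T t) y.1 y.2 + ψ (batchIdx B T t) y.1 y.2)) * f y :=
      (((hmeas hφ t).add (hmeas hψ t)).exp.ennreal_ofReal).mul hf
    rw [BanditAlg.lintegral_envKernel _ _ _ _ hf, BanditAlg.lintegral_envKernel _ _ _ _ hw]
    exact lintegral_mono fun i => hdens _ i _ (hf.comp measurable_prodMk_left)
  · refine BanditAlg.lintegral_envKernel_le _ _ _ _ ?_ fun i => hs1 _ i
    exact ((((hmeas hφ t).sub (hmeas (f := fun b i _ => (KL (Q b i) (P i)).toReal) (fun b i =>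
      measurable_const) t)).sub_const δ).const_mul s).exp.ennreal_ofReal
  · exact BanditAlg.lintegral_envKernel_le _ _ _ _ (hmeas hψ t).ennreal_ofReal fun i => hη _ i
  · exact Set.indicator_le_self' (fun _ _ => zero_le) h |>.trans prob_le_one
  have hlaw : ∫⁻ h in trackEvent T ε B c, (π T).recommend h {j} ∂(batchLaw (π T) Q) =
      ∫⁻ h, g h ∂(chainLaw ((π T).envKernel fun t => Q (batchIdx B T t)) T) := by
    rw [← lintegral_indicator hmE]
    rfl
  rw [hlaw] at hT
  have hP : ∫⁻ h, g h ∂(chainLaw ((π T).envKernel fun _ => P) T) ≤ (π T).errorProb P :=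
    (lintegral_mono (Set.indicator_le_self' fun _ _ => zero_le)).trans
      ((π T).lintegral_recommend_le_errorProb P hj)
  by_contra! hlt
  refine absurd (hT.trans_le key) (not_lt.2 ?_)
  set Y := S * (T / B + 1) + 3 * T * δ
  calc ENNReal.ofReal (Real.exp Y) * ∫⁻ h, g h ∂(chainLaw ((π T).envKernel fun _ => P) T) +
        ENNReal.ofReal (Real.exp (-(s * T * δ))) + ENNReal.ofReal (δ * (a / 4) / δ)
      ≤ ENNReal.ofReal (Real.exp Y) * ENNReal.ofReal (a / 2 * Real.exp (-Y)) +
        ENNReal.ofReal (a / 4) + ENNReal.ofReal (a / 4) := by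
        refine add_le_add (add_le_add (mul_le_mul_right (hP.trans hlt.le) _)
          (ENNReal.ofReal_le_ofReal hTe)) (le_of_eq ?_)
        rw [mul_div_cancel_left₀ _ hδ.ne']
    _ = ENNReal.ofReal a := by
        rw [← ENNReal.ofReal_mul (Real.exp_nonneg _), ← ENNReal.ofReal_add (by positivity)
          (by positivity), ← ENNReal.ofReal_add (by positivity) (by positivity)]
        congr 1
        have : Real.exp Y * (a / 2 * Real.exp (-Y)) = a / 2 := by
          rw [mul_left_comm, ← Real.exp_add]
          simp
        rw [this]
        ring

/-- The exponential rate of error under `P` is at most the average of the divergences, weighted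
with the typical allocations `c`, up to the slack `ε` of the allocations. -/
theorem liminf_rate_le (π : (T : ℕ) → BanditAlg K T) {ε : ℝ} (hε : 0 < ε)
    {c : Fin B → stdSimplex ℝ (Fin K)} {j : Fin K} {Q : Fin B → Fin K → ProbabilityMeasure ℝ}
    {P : Fin K → ProbabilityMeasure ℝ} (hj : j ∉ bestArms P)
    (hQ : ¬Tendsto (fun T => ∫⁻ h in trackEvent T ε B c,
      (π T).recommend h {j} ∂(batchLaw (π T) Q)) atTop (nhds 0)) :
    liminf (fun T : ℕ => (ENNReal.log ((π T).errorProb P)⁻¹).toENNReal / (T : ℝ≥0∞)) atTop ≤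
      (∑ i, ∑ b, ENNReal.ofReal ((c b).1 i + ε) * KL (Q b i) (P i)) / (B : ℝ≥0∞) := by
  have hB : (0 : ℝ) < B := by exact_mod_cast NeZero.pos B
  have hc : ∀ b i, 0 < (c b).1 i + ε := fun b i => add_pos_of_nonneg_of_pos ((c b).2.1 i) hε
  by_cases hD : ∀ b i, KL (Q b i) (P i) ≠ ⊤
  swap
  · -- every arm has positive weight, so an infinite divergence makes the bound trivial
    push Not at hD
    obtain ⟨b, i, hbi⟩ := hD
    have : ∑ i, ∑ b, ENNReal.ofReal ((c b).1 i + ε) * KL (Q b i) (P i) = ⊤ := by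
      refine ENNReal.sum_eq_top.2 ⟨i, Finset.mem_univ i, ENNReal.sum_eq_top.2
        ⟨b, Finset.mem_univ b, ?_⟩⟩
      rw [hbi, ENNReal.mul_top]
      simpa using hc b i
    rw [this, ENNReal.top_div_of_ne_top (ENNReal.natCast_ne_top B)]
    exact le_top
  set S := ∑ b, ∑ i, ((c b).1 i + ε) * (KL (Q b i) (P i)).toReal with hS
  have hS0 : 0 ≤ S := Finset.sum_nonneg fun b _ => Finset.sum_nonneg fun i _ =>
    mul_nonneg (hc b i).le ENNReal.toReal_nonneg
  have hrhs : (∑ i, ∑ b, ENNReal.ofReal ((c b).1 i + ε) * KL (Q b i) (P i)) / (B : ℝ≥0∞) =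
      ENNReal.ofReal (S / B) := by
    rw [ENNReal.ofReal_div_of_pos hB, ENNReal.ofReal_natCast, hS, Finset.sum_comm,
      ENNReal.ofReal_sum_of_nonneg fun b _ => Finset.sum_nonneg fun i _ =>
        mul_nonneg (hc b i).le ENNReal.toReal_nonneg]
    congr 1
    refine Finset.sum_congr rfl fun b _ => ?_
    rw [ENNReal.ofReal_sum_of_nonneg fun i _ => mul_nonneg (hc b i).le ENNReal.toReal_nonneg]
    refine Finset.sum_congr rfl fun i _ => ?_
    rw [ENNReal.ofReal_mul (hc b i).le, ENNReal.ofReal_toReal (hD b i)]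
  rw [hrhs]
  refine ENNReal.le_of_forall_pos_le_add fun e he _ => ?_
  have he0 : (0 : ℝ) < e := he
  obtain ⟨a, ha, hfreq⟩ := frequently_le_errorProb π hε hj hD hQ (δ := e / 6) (by positivity)
  rw [← ENNReal.ofReal_coe_nnreal, ← ENNReal.ofReal_add (by positivity) he0.le]
  have hlarge : ∀ᶠ T : ℕ in atTop, S - Real.log a ≤ e / 2 * T :=
    (tendsto_natCast_atTop_atTop.const_mul_atTop (by positivity)).eventually_ge_atTop _
  refine liminf_le_of_frequently_le
    ((hfreq.and_eventually (hlarge.and (eventually_gt_atTop 0))).mono ?_)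
  rintro T ⟨hT, hTl, hT0⟩
  have hT0' : (0 : ℝ) < T := by exact_mod_cast hT0
  set Y := S * (T / B + 1) + 3 * T * (e / 6) with hY
  have h1 : ENNReal.log ((π T).errorProb P)⁻¹ ≤ ((Y - Real.log a : ℝ) : EReal) := by
    have h2 := ENNReal.log_le_log (ENNReal.inv_le_inv.2 hT)
    rwa [← ENNReal.ofReal_inv_of_pos (by positivity), ENNReal.log_ofReal_of_pos (by positivity),
      Real.log_inv, Real.log_mul ha.ne' (Real.exp_pos _).ne', Real.log_exp,
      show -(Real.log a + -Y) = Y - Real.log a by ring] at h2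
  calc (ENNReal.log ((π T).errorProb P)⁻¹).toENNReal / (T : ℝ≥0∞)
      ≤ ENNReal.ofReal (Y - Real.log a) / (T : ℝ≥0∞) := by
        gcongr
        exact EReal.toENNReal_le_toENNReal h1
    _ = ENNReal.ofReal ((Y - Real.log a) / T) := by
        rw [ENNReal.ofReal_div_of_pos hT0', ENNReal.ofReal_natCast]
    _ ≤ ENNReal.ofReal (S / B + e) := by
        refine ENNReal.ofReal_le_ofReal ?_
        rw [div_le_iff₀ hT0', hY]
        have : S * (T / B + 1) = S / B * T + S := by ring
        rw [this]
        linarith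

end UpperBound

/-- The typical allocations, mixed with a small multiple of the uniform allocation, form a batch
oracle whose value is at least the rate of the algorithm up to a factor close to one. -/
theorem worstCaseRate_le_mul_RgoB (M : RewardModel) {K : ℕ} (hK : 1 ≤ K)
    (H : (Fin K → M.classP) → ℝ≥0∞) (π : (T : ℕ) → BanditAlg K T) {B : ℕ}
    (hB : 1 ≤ B) {ε : ℝ} (hε : 0 < ε) :
    worstCaseRate M H π ≤ ENNReal.ofReal (1 + K * ε) * RgoB M H B := by
  have : NeZero B := ⟨by omega⟩
  obtain ⟨r, J, hrJ⟩ := exists_typical_rules (B := B) hK π hε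
  have hw : 0 < 1 + K * ε := by positivity
  have hw0 : ENNReal.ofReal (1 + K * ε) ≠ 0 := by simpa using hw
  let r' : BatchAlloc M K B := fun b x =>
    ⟨fun i => ((r b fun a i => (x a i).1).1 i + ε) / (1 + K * ε), fun i =>
      div_nonneg (add_nonneg ((r b fun a i => (x a i).1).2.1 i) hε.le) hw.le, by
        rw [← Finset.sum_div, Finset.sum_add_distrib, (r b fun a i => (x a i).1).2.2]
        simp [hw.ne']⟩
  let J' : BatchRec M K B := fun x => J fun b i => (x b i).1
  suffices h : worstCaseRate M H π / ENNReal.ofReal (1 + K * ε) ≤ batchValue M H r' J' by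
    rw [← ENNReal.div_le_iff' hw0 ENNReal.ofReal_ne_top]
    exact h.trans (le_iSup₂ (f := fun r J => batchValue M H r J) r' J')
  refine le_iInf fun Q => le_iInf₂ fun P hP => ENNReal.div_le_of_le_mul' ?_
  refine (iInf_le _ P).trans ((mul_le_mul_right (liminf_rate_le π hε hP
    (hrJ fun b i => (Q b i).1)) _).trans (le_of_eq ?_))
  have hterm : ∀ (b : Fin B) (i : Fin K),
      ENNReal.ofReal ((r b fun a i => (Q (Fin.castLE b.2 a) i).1).1 i + ε) =
        ENNReal.ofReal (1 + K * ε) * ENNReal.ofReal ((r' b fun a => Q (Fin.castLE b.2 a)).1 i) := by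
    intro b i
    rw [← ENNReal.ofReal_mul hw.le]
    congr 1
    exact (mul_div_cancel₀ _ hw.ne').symm
  simp_rw [hterm, mul_assoc, ← Finset.mul_sum]
  rw [ENNReal.div_eq_inv_mul, ENNReal.div_eq_inv_mul]
  ring

theorem worstCaseRate_le_RgoB (M : RewardModel) {K : ℕ} (hK : 1 ≤ K)
    (H : (Fin K → M.classP) → ℝ≥0∞) (π : (T : ℕ) → BanditAlg K T) {B : ℕ}
    (hB : 1 ≤ B) : worstCaseRate M H π ≤ RgoB M H B := by
  have h1 : Tendsto (fun ε : ℝ => ENNReal.ofReal (1 + K * ε)) (nhdsWithin 0 (Set.Ioi 0))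
      (nhds 1) := by
    have : Continuous fun ε : ℝ => ENNReal.ofReal (1 + K * ε) :=
      ENNReal.continuous_ofReal.comp (by fun_prop)
    simpa using (this.tendsto 0).mono_left nhdsWithin_le_nhds
  have h2 := ENNReal.Tendsto.mul_const (b := RgoB M H B) h1 (Or.inl one_ne_zero)
  rw [one_mul] at h2
  refine ge_of_tendsto h2 ?_
  filter_upwards [self_mem_nhdsWithin] with ε hε
  exact worstCaseRate_le_mul_RgoB M hK H π hB hε

theorem mainTheorem8 (M : RewardModel) :
    -- convex combinations are well defined in the model, and the KL divergence is convex
    (∀ α : ℝ, 0 ≤ α → α ≤ 1 → ∀ Q ∈ M.classQ, ∀ Q' ∈ M.classQ,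
      (∃! R, R ∈ M.classQ ∧ M.IsConvexComb α Q Q' R) ∧
      ∀ R ∈ M.classQ, M.IsConvexComb α Q Q' R → ∀ P ∈ M.classQ,
        KL R P ≤ ENNReal.ofReal α * KL Q P + ENNReal.ofReal (1 - α) * KL Q' P) ∧
    ∀ (K : ℕ), 1 ≤ K → ∀ (H : (Fin K → M.classP) → ℝ≥0∞), (∀ P, 0 < H P) →
      -- bound for oracle algorithms
      (∀ π : (T : ℕ) → BanditAlg K T, worstCaseRate M H π ≤ Rgo M H) ∧
      -- bound for batch-oracle algorithms
      (∀ π : (T : ℕ) → BanditAlg K T, ∀ B : ℕ, 1 ≤ B → worstCaseRate M H π ≤ RgoB M H B) ∧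
      -- comparison of the two bounds
      (∀ B : ℕ, 1 ≤ B → RgoB M H B ≤ Rgo M H) ∧
      -- divergence guarantee of delayed optimal tracking with an `ε`-optimal oracle
      (∀ B : ℕ, 1 ≤ B → ∀ ε : ℝ≥0, 0 < ε →
        ∀ (rstar : BatchAlloc M K B) (Jstar : BatchRec M K B),
          RgoB M H B - ε ≤ batchValue M H rstar Jstar →
          ∀ (run : DOTRun M rstar Jstar) (P : Fin K → M.classP),
            run.recommended ∉ bestArms (fun i => (P i).1) →
            (B : ℝ≥0∞) / ((B + K - 1 : ℕ) : ℝ≥0∞) * ((RgoB M H B - ε) / H P) ≤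
              ((B + K - 1 : ℕ) : ℝ≥0∞)⁻¹ *
                ∑ i, ∑ b ∈ Finset.range (B + K - 1),
                  ENNReal.ofReal ((run.alloc b).1 i) * KL (run.estimate b i).1 (P i).1) := by
  refine ⟨fun α h0 h1 Q hQ Q' hQ' => ⟨M.existsUnique_isConvexComb h0 h1 hQ hQ',
    fun R hR hc P hP => M.kl_le_of_isConvexComb h0 h1 hQ hQ' hR hc hP⟩,
    fun K hK H _ => ⟨?_, ?_, ?_, ?_⟩⟩
  · exact fun π => (worstCaseRate_le_RgoB M hK H π le_rfl).trans (RgoB_le_Rgo M H le_rfl)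
  · exact fun π B hB => worstCaseRate_le_RgoB M hK H π hB
  · exact fun B hB => RgoB_le_Rgo M H hB
  · exact fun B hB ε _ rstar Jstar hv run P hP => run.divergence_guarantee hB hv P hP
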